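/- **Quasi-static eigenfracture evolution.** *Setting.* Let $\Omega\subset\Omega'\subset\mathbb R^d$ be bounded open sets, let $h>0$, and let $\mathcal T_h$ be a (locally finite, conforming) triangulation of $\mathbb R^d$ into closed simplices of diameter at most $h$. Let $V_h(\Omega')$ be the space of continuous functions which are affine, and $W_h(\Omega')$ the space of $\mathbb R^d$-valued functions which are constant, on each of the simplices of $\mathcal T_h$ intersecting $\Omega'$. Let $\varepsilon>0$, $\kappa>0$, and $Q(F)=F^T\mathbb CF$ with $\mathbb C\in\mathbb R^{d\times d}$ symmetric and $Q(F)>0$ for all $F\ne0$. For $\gamma\in W_h(\Omega')$ let $\{\gamma\neq0\}$ be the union of the closed simplices on which the constant value of $\gamma$ is not $0$. For a set $A$ let $U^{\mathcal T}_\varepsilon(A)$ be the union of all simplices of $\mathcal T_h$ intersecting the closed $\varepsilon$-neighbourhood of $A$. For $u\in V_h(\Omega')$, $\gamma\in W_h(\Omega')$ and a union $\Psi$ of simplices intersecting $\Omega'$ put $$\mathcal E_\varepsilon(u,\gamma,\Psi)=\int_\Omega Q(\nabla u-\gamma)\,dx+\frac{\kappa}{2\varepsilon}\mathcal L^d\big(U^{\mathcal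 T}_\varepsilon(\Psi\cup\{\gamma\ne0\})\big).$$ For $\bar g\in V_h(\Omega')$ let $\mathcal A(\bar g)$ be the set of all $(\bar u,\bar\gamma)\in V_h(\Omega')\times W_h(\Omega')$ with $\bar u=\bar g$ and $\bar\gamma=0$ on $\Omega'\setminus\overline\Omega$, and let $AD_\varepsilon(\bar g)$ be the set of all $(\bar u,\bar\gamma,\bar\Gamma)$ such that $(\bar u,\bar\gamma)\in\mathcal A(\bar g)$, $\bar\Gamma$ is a union of simplices of $\mathcal T_h$ intersecting $\Omega'$, and $\{\bar\gamma\ne0\}\subset\bar\Gamma$. Let $g_h\in W^{1,1}([0,1];V_h(\Omega'))$ (continuous representative); for instance, the interpolation on $\mathcal T_h$ of some $g\in W^{1,1}([0,1];W^{2,\infty}(\mathbb R^d))$. For $m\in\mathbb N$ let $I_m=\{0=t^m_0<t^m_1<\dots<t^m_m\}\subset[0,1]$ with $I_m\subset I_{m+1}$, $\bigcup_mI_m$ dense in $[0,1]$, and $\max_{1\le i\le m}(t^m_i-t^m_{i-1})\to0$. A *time-discrete solution* at level $m$ is a family $(u^m_k,\gamma^m_k)_{0\le k\le m}$ with $(u^m_k,\gamma^m_k)\in\mathcal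 A(g_h(t^m_k))$ such that $(u_0^m,\gamma_0^m)$ minimizes $\mathcal E_\varepsilon(\cdot,\cdot,\emptyset)$ over $\mathcal A(g_h(0))$ and, for $0\le i<m$, $(u^m_{i+1},\gamma^m_{i+1})$ minimizes $\mathcal E_\varepsilon(\cdot,\cdot,\Gamma^m_i)$ over $\mathcal A(g_h(t^m_{i+1}))$, where $\Gamma^m_k:=\bigcup_{j\le k}\{\gamma^m_j\ne0\}$. For $t\in[0,1]$ let $k(m,t)$ be the largest $k\le m$ with $t^m_k\le t$. *Theorem.* Time-discrete solutions exist for every $m$. Moreover, for every choice of time-discrete solutions $(u^m_k,\gamma^m_k)_{0\le k\le m}$, $m\in\mathbb N$, there is a mapping $t\mapsto(u_\varepsilon(t),\gamma_\varepsilon(t),\Gamma_\varepsilon(t))\in AD_\varepsilon(g_h(t))$, $t\in[0,1]$, such that: (a) *Initial condition:* $(u_\varepsilon(0),\gamma_\varepsilon(0))$ minimizes $\mathcal E_\varepsilon(\cdot,\cdot,\emptyset)$ over $\mathcal A(g_h(0))$. (b) *Irreversibility:* $\Gamma_\varepsilon(s)\subset\Gamma_\varepsilon(t)$ for all $0\le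 s\le t\le1$. (c) *Global stability:* for all $t\in(0,1]$ and all $(\bar u,\bar\gamma)\in\mathcal A(g_h(t))$, $\ \mathcal E_\varepsilon(u_\varepsilon(t),\gamma_\varepsilon(t),\Gamma_\varepsilon(t))\le\mathcal E_\varepsilon(\bar u,\bar\gamma,\Gamma_\varepsilon(t))$. (d) *Energy balance:* $t\mapsto\mathcal E_\varepsilon(u_\varepsilon(t),\gamma_\varepsilon(t),\Gamma_\varepsilon(t))$ is absolutely continuous on $[0,1]$, the function $s\mapsto\int_\Omega(\nabla u_\varepsilon(s)-\gamma_\varepsilon(s))\cdot\mathbb C\,\partial_t\nabla g_h(s)\,dx$ is integrable on $(0,1)$, and for all $t\in[0,1]$ $$\mathcal E_\varepsilon(u_\varepsilon(t),\gamma_\varepsilon(t),\Gamma_\varepsilon(t))=\mathcal E_\varepsilon(u_\varepsilon(0),\gamma_\varepsilon(0),\emptyset)+2\int_0^t\int_\Omega(\nabla u_\varepsilon(s)-\gamma_\varepsilon(s))\cdot\mathbb C\,\partial_t\nabla g_h(s)\,dx\,ds.$$ Furthermore, along a subsequence of $m\to\infty$ that does not depend on $t$, for all $t\in[0,1]$,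 $$\mathcal E_\varepsilon(u^m_{k(m,t)},\gamma^m_{k(m,t)},\Gamma^m_{k(m,t)})\to\mathcal E_\varepsilon(u_\varepsilon(t),\gamma_\varepsilon(t),\Gamma_\varepsilon(t)),$$ $$u^m_{k(m,t)}\to u_\varepsilon(t)\ \text{in }L^1(G_\varepsilon(t)),\qquad \nabla u^m_{k(m,t)}\mathbf 1_{(\Gamma^m_{k(m,t)})^c}\to\nabla u_\varepsilon(t)-\gamma_\varepsilon(t)\ \text{in }L^2(\Omega';\mathbb R^d),$$ where $G_\varepsilon(t)\subset\Omega'$ is the union of those connected components of $\big(\Omega'\setminus U^{\mathcal T}_\varepsilon(\Gamma_\varepsilon(t))\big)\cup(\Omega'\setminus\overline\Omega)$ that intersect $\Omega'\setminus\overline\Omega$. -/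

import Mathlib

open Set Filter Topology MeasureTheory

noncomputable section

namespace Eigenfracture

/-- Euclidean space `ℝ^d`. -/
abbrev E (d : ℕ) : Type := EuclideanSpace ℝ (Fin d)

/-- A simplicial complex in `ℝ^d` (complexes are given by the vertex sets of their faces). -/
abbrev Mesh (d : ℕ) : Type := Geometry.SimplicialComplex ℝ (E d)

/-- The closed simplex spanned by a finite set of vertices. -/
def simplex {d : ℕ} (s : Finset (E d)) : Set (E d) := convexHull ℝ (s : Set (E d))

/-- `K` is a triangulation of `ℝ^d` of mesh size at most `h`: a locally finite simplicial complex
that covers `ℝ^d`, all of whose simplices have diameter at most `h`. -/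
structure IsTriangulation {d : ℕ} (K : Mesh d) (h : ℝ) : Prop where
  covers : K.space = univ
  locallyFinite : LocallyFinite (fun s : K.faces => simplex (s : Finset (E d)))
  diam_le : ∀ s ∈ K.faces, Metric.diam (simplex s) ≤ h

/-- The (vertex sets of the) `d`-dimensional simplices of the triangulation that intersect `A`. -/
def cells {d : ℕ} (K : Mesh d) (A : Set (E d)) : Set (Finset (E d)) :=
  {s | s ∈ K.faces ∧ s.card = d + 1 ∧ (simplex s ∩ A).Nonempty}

/-- The region covered by the simplices that intersect `A`. -/
def cellRegion {d : ℕ} (K : Mesh d) (A : Set (E d)) : Set (E d) :=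
  ⋃ s ∈ cells K A, simplex s

/-- The finite element space `V_h(D)`: continuous functions on the union of the simplices
intersecting `D` that are affine on each of these simplices (values elsewhere play no role). -/
def contFE {d : ℕ} (K : Mesh d) (D : Set (E d)) : Set (E d → ℝ) :=
  {u | ContinuousOn u (cellRegion K D) ∧
    ∀ s ∈ cells K D, ∃ a : E d →ᵃ[ℝ] ℝ, EqOn u a (simplex s)}

/-- The finite element space `W_h(D)`: `ℝ^d`-valued functions that are constant on (the interior
of) each simplex intersecting `D`. Values on the boundaries of the simplices, a null set, and
outside these simplices play no role. -/
def constFE {d : ℕ} (K : Mesh d) (D : Set (E d)) : Set (E d → E d) :=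
  {γ | ∀ s ∈ cells K D, ∃ c : E d, ∀ x ∈ interior (simplex s), γ x = c}

/-- The set `{γ ≠ 0}` for `γ ∈ W_h(D)`: the union of those closed simplices on which the constant
value of `γ` is non-zero. -/
def support {d : ℕ} (K : Mesh d) (D : Set (E d)) (γ : E d → E d) : Set (E d) :=
  ⋃ s ∈ {s ∈ cells K D | ∃ x ∈ interior (simplex s), γ x ≠ 0}, simplex s

/-- The union of all simplices that intersect the closed `ε`-neighbourhood of `A`. -/
def meshNhd {d : ℕ} (K : Mesh d) (ε : ℝ) (A : Set (E d)) : Set (E d) :=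
  cellRegion K (Metric.cthickening ε A)

/-- The bilinear form `F ↦ F ⋅ C G` on `ℝ^d`. -/
def form {d : ℕ} (C : Matrix (Fin d) (Fin d) ℝ) (F G : E d) : ℝ :=
  F.ofLp ⬝ᵥ (C.mulVec G.ofLp)

/-- The eigenfracture energy of `(u, γ)` with pre-existing crack set `Ψ`. -/
def energy {d : ℕ} (K : Mesh d) (Ω Ω' : Set (E d)) (C : Matrix (Fin d) (Fin d) ℝ) (κ ε : ℝ)
    (u : E d → ℝ) (γ : E d → E d) (Ψ : Set (E d)) : ℝ :=
  (∫ x in Ω, form C (gradient u x - γ x) (gradient u x - γ x)) +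
    κ / (2 * ε) * (volume (meshNhd K ε (Ψ ∪ support K Ω' γ))).toReal

/-- Pairs `(u, γ) ∈ V_h(Ω') × W_h(Ω')` with `u = g` and `γ = 0` on `Ω' \ closure Ω`. -/
def admissible {d : ℕ} (K : Mesh d) (Ω Ω' : Set (E d)) (g : E d → ℝ) :
    Set ((E d → ℝ) × (E d → E d)) :=
  {p | p.1 ∈ contFE K Ω' ∧ p.2 ∈ constFE K Ω' ∧
    ∀ x ∈ Ω' \ closure Ω, p.1 x = g x ∧ p.2 x = 0}

/-- Admissible triples `(u, γ, Γ)`: in addition, `Γ` is a union of simplices of the mesh (of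
`Ω'`) that contains `{γ ≠ 0}`. -/
def admissibleTriple {d : ℕ} (K : Mesh d) (Ω Ω' : Set (E d)) (g : E d → ℝ) :
    Set ((E d → ℝ) × (E d → E d) × Set (E d)) :=
  {p | (p.1, p.2.1) ∈ admissible K Ω Ω' g ∧
    (∃ S ⊆ cells K Ω', p.2.2 = ⋃ s ∈ S, simplex s) ∧ support K Ω' p.2.1 ⊆ p.2.2}

/-- `W^{1,1}([0,1]; V_h(D))`. For bounded `D` the space `V_h(D)` is finite-dimensional, so these are
the absolutely continuous curves in `V_h(D)`, that is, the curves in `V_h(D)` all of whose point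
values (equivalently, nodal values) are absolutely continuous in time. -/
def sobolevCurves {d : ℕ} (K : Mesh d) (D : Set (E d)) : Set (ℝ → E d → ℝ) :=
  {g | (∀ t ∈ Icc (0 : ℝ) 1, g t ∈ contFE K D) ∧
    ∀ x ∈ cellRegion K D, AbsolutelyContinuousOnInterval (fun t => g t x) 0 1}

/-- Nested time grids `I_m = {0 = τ m 0 < τ m 1 < ⋯ < τ m m} ⊆ [0,1]` with dense union and with
maximal step size tending to zero. -/
structure IsTimeGrid (τ : ℕ → ℕ → ℝ) : Prop where
  zero : ∀ m, τ m 0 = 0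
  mem : ∀ m, ∀ i ≤ m, τ m i ∈ Icc (0 : ℝ) 1
  strictMono : ∀ m i j, i < j → j ≤ m → τ m i < τ m j
  nested : ∀ m, τ m '' Iic m ⊆ τ (m + 1) '' Iic (m + 1)
  dense : Icc (0 : ℝ) 1 ⊆ closure (⋃ m, τ m '' Iic m)
  step : ∀ δ > 0, ∃ M, ∀ m ≥ M, ∀ i < m, τ m (i + 1) - τ m i < δ

open scoped Classical in
/-- The index `k = k(m,t) ≤ m` with `σ k ≤ t < σ (k+1)` (with `k = m` if `σ m ≤ t`), for a grid
`0 = σ 0 < σ 1 < ⋯ < σ m` and `t ≥ 0`. -/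
def stepIndex (σ : ℕ → ℝ) (m : ℕ) (t : ℝ) : ℕ := Nat.findGreatest (fun k => σ k ≤ t) m

/-- The crack set `⋃_{j ≤ k} {γ_j ≠ 0}` accumulated up to the `k`-th time step. -/
def discreteCrack {d : ℕ} (K : Mesh d) (D : Set (E d)) (γ : ℕ → E d → E d) (k : ℕ) : Set (E d) :=
  ⋃ j ∈ Iic k, support K D (γ j)

/-- `(u_k, γ_k)_{0 ≤ k ≤ m}` solves the incremental minimization problems on the grid
`σ 0 < ⋯ < σ m` for the boundary data `g`. -/
structure IsDiscreteSolution {d : ℕ} (K : Mesh d) (Ω Ω' : Set (E d))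
    (C : Matrix (Fin d) (Fin d) ℝ) (κ ε : ℝ) (g : ℝ → E d → ℝ) (σ : ℕ → ℝ) (m : ℕ)
    (u : ℕ → E d → ℝ) (γ : ℕ → E d → E d) : Prop where
  mem : ∀ k ≤ m, (u k, γ k) ∈ admissible K Ω Ω' (g (σ k))
  initial : ∀ p ∈ admissible K Ω Ω' (g (σ 0)),
    energy K Ω Ω' C κ ε (u 0) (γ 0) ∅ ≤ energy K Ω Ω' C κ ε p.1 p.2 ∅
  next : ∀ i < m, ∀ p ∈ admissible K Ω Ω' (g (σ (i + 1))),
    energy K Ω Ω' C κ ε (u (i + 1)) (γ (i + 1)) (discreteCrack K Ω' γ i) ≤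
      energy K Ω Ω' C κ ε p.1 p.2 (discreteCrack K Ω' γ i)

/-- The power `∫_Ω (∇u(s) - γ(s)) ⋅ C ∂ₜ∇g(s) dx` at time `s`. -/
def power {d : ℕ} (Ω : Set (E d)) (C : Matrix (Fin d) (Fin d) ℝ) (g : ℝ → E d → ℝ)
    (u : ℝ → E d → ℝ) (γ : ℝ → E d → E d) (s : ℝ) : ℝ :=
  ∫ x in Ω, form C (gradient (u s) x - γ s x) (deriv (fun r => gradient (g r) x) s)

/-- `t ↦ (u(t), γ(t), Γ(t))` is an irreversible quasi-static eigenfracture evolution on `[0,1]`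
with boundary data `g`. -/
structure IsEvolution {d : ℕ} (K : Mesh d) (Ω Ω' : Set (E d))
    (C : Matrix (Fin d) (Fin d) ℝ) (κ ε : ℝ) (g : ℝ → E d → ℝ)
    (u : ℝ → E d → ℝ) (γ : ℝ → E d → E d) (Γ : ℝ → Set (E d)) : Prop where
  mem : ∀ t ∈ Icc (0 : ℝ) 1, (u t, γ t, Γ t) ∈ admissibleTriple K Ω Ω' (g t)
  initial : ∀ p ∈ admissible K Ω Ω' (g 0),
    energy K Ω Ω' C κ ε (u 0) (γ 0) ∅ ≤ energy K Ω Ω' C κ ε p.1 p.2 ∅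
  irreversible : ∀ s t, 0 ≤ s → s ≤ t → t ≤ 1 → Γ s ⊆ Γ t
  stable : ∀ t ∈ Ioc (0 : ℝ) 1, ∀ p ∈ admissible K Ω Ω' (g t),
    energy K Ω Ω' C κ ε (u t) (γ t) (Γ t) ≤ energy K Ω Ω' C κ ε p.1 p.2 (Γ t)
  absCont : AbsolutelyContinuousOnInterval
    (fun t => energy K Ω Ω' C κ ε (u t) (γ t) (Γ t)) 0 1
  power_integrable : IntervalIntegrable (power Ω C g u γ) volume 0 1
  balance : ∀ t ∈ Icc (0 : ℝ) 1,
    energy K Ω Ω' C κ ε (u t) (γ t) (Γ t) =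
      energy K Ω Ω' C κ ε (u 0) (γ 0) ∅ + 2 * ∫ s in (0 : ℝ)..t, power Ω C g u γ s

/-- The part of `Ω'` that is not broken off by the crack set `Γ`: the union of those connected
components of `(Ω' \ U) ∪ (Ω' \ closure Ω)` which meet `Ω' \ closure Ω`, where `U` is the
union of the simplices intersecting the closed `ε`-neighbourhood of `Γ`. -/
def goodSet {d : ℕ} (K : Mesh d) (Ω Ω' : Set (E d)) (ε : ℝ) (Γ : Set (E d)) : Set (E d) :=
  ⋃ y ∈ Ω' \ closure Ω, connectedComponentIn ((Ω' \ meshNhd K ε Γ) ∪ (Ω' \ closure Ω)) y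

end Eigenfracture

end

open Eigenfracture

namespace Eigenfracture

/-! ### Selection of a convergent subsequence of monotone set-valued curves -/

/-! Only finitely many cells meet `Ω'`, so a crack is a subset `P` of a finite set and the problem
is quadratic once `P` is fixed. Write `X` for the cellwise gradient of the boundary datum and `b`
for the elastic form. The strains `∇u - γ` attainable with `γ` living on `P` form the affine space
`X - variations P`, on whose direction `b` is definite (`elasticForm_definite`). The optimal strain
is therefore `T P X` with `T P` linear, and minimizing out `(u, γ)` leaves the reduced energy `e(P,
X) = b(T P X, T P X) + ν P`. Minimizers are thus described by minimizing `e` over finitely many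
supersets of the old crack (`minimizer_characterization`), which also yields existence.

For the evolution (`exists_reduced_evolution`), comparing consecutive discrete states in both
directions bounds the change of energy by the variation of the data. A Helly-type selection makes
the discrete cracks eventually equal to a limit `S t` for every `t`, so stability and the energy
bound pass to the limit pointwise, and the limit energy is absolutely continuous. Each cell is
cracked on an interval of times, so `S` is locally constant off a null set. There the energy is
differentiated at fixed crack, and orthogonality gives the derivative `2 b(T S X, X')`. Integration
gives the balance as an equality.

Strains converge because `T P` is continuous. Displacements converge on the part still attached to
the outer region because smallness spreads through uncracked cells along connected components. -/

theorem exists_subseq_eventually_eq {α ι : Type*} [LinearOrder α] [Finite ι] (s : Set α)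
    (A : ℕ → α → Set ι) (hA : ∀ m, MonotoneOn (A m) s) :
    ∃ (φ : ℕ → ℕ) (Q : α → Set ι), StrictMono φ ∧ ∀ t ∈ s, ∀ᶠ n in atTop, A (φ n) t = Q t := by
  classical
  have := Fintype.ofFinite ι
  have key : ∀ J : Finset ι, ∃ φ : ℕ → ℕ, StrictMono φ ∧ ∀ i ∈ J, ∀ t ∈ s,
      ∃ c : Prop, ∀ᶠ n in atTop, (i ∈ A (φ n) t ↔ c) := by
    intro J
    induction J using Finset.induction_on with
    | empty => exact ⟨id, strictMono_id, by simp⟩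
    | insert i J _ ih =>
      obtain ⟨φ, hφ, hJ⟩ := ih
      -- Monotonicity makes these sets upper subsets of a linear order, hence a chain under
      -- inclusion. Ramsey's alternative then leaves a subsequence that increases, or one in which
      -- no set lies in a later one, that is, a decreasing one. In both cases membership of a fixed
      -- `t` changes at most once.
      obtain ⟨ψ, hψ⟩ := exists_increasing_or_nonincreasing_subseq
        (fun U V : Set α => U ⊆ V) (fun n => {t | t ∈ s ∧ i ∈ A (φ n) t})
      refine ⟨φ ∘ ψ, hφ.comp ψ.strictMono, fun j hj t ht => ?_⟩
      rcases Finset.mem_insert.1 hj with rfl | hj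
      · rcases hψ with hψ | hψ
        · by_cases h : ∃ n, j ∈ A (φ (ψ n)) t
          · obtain ⟨n, hn⟩ := h
            refine ⟨True, ?_⟩
            filter_upwards [eventually_gt_atTop n] with m hm
            have := hψ n m hm ⟨ht, hn⟩
            simpa using this.2
          · push Not at h
            exact ⟨False, Eventually.of_forall fun n => by simpa using h n⟩
        · by_cases h : ∃ n, j ∉ A (φ (ψ n)) t
          · obtain ⟨n, hn⟩ := h
            refine ⟨False, ?_⟩
            filter_upwards [eventually_gt_atTop n] with m hm
            obtain ⟨r, hr, hr'⟩ := Set.not_subset.1 (hψ n m hm)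
            simp only [Function.comp_apply, iff_false]
            intro hmt
            rcases le_total r t with hrt | hrt
            · exact hn (hA _ hr.1 ht hrt hr.2)
            · exact hr' ⟨hr.1, hA _ ht hr.1 hrt hmt⟩
          · push Not at h
            exact ⟨True, Eventually.of_forall fun n => by simpa using h n⟩
      · obtain ⟨c, hc⟩ := hJ j hj t ht
        exact ⟨c, ψ.strictMono.tendsto_atTop.eventually hc⟩
  obtain ⟨φ, hφ, h⟩ := key Finset.univ
  choose! c hc using h
  refine ⟨φ, fun t => {i | c i t}, hφ, fun t ht => ?_⟩
  have := eventually_all.2 fun i => hc i (Finset.mem_univ i) t ht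
  filter_upwards [this] with n hn
  ext i
  exact hn i

/-- A monotone curve of subsets of a finite type is locally constant off a null set. -/
theorem ae_eventually_eq_of_monotoneOn {ι : Type*} [Finite ι] (Q : ℝ → Set ι)
    (hQ : MonotoneOn Q (Icc 0 1)) :
    ∀ᵐ s : ℝ, s ∈ Ioo (0 : ℝ) 1 → ∀ᶠ r in 𝓝 s, Q r = Q s := by
  -- Once `i` enters it stays, so its times form an interval. Off the finitely many null frontiers,
  -- membership of every `i` is locally constant.
  have hconv : ∀ i, Convex ℝ {t | t ∈ Icc (0 : ℝ) 1 ∧ i ∈ Q t} := by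
    intro i
    refine Set.OrdConnected.convex ⟨fun x hx y hy z hz => ?_⟩
    have hz' : z ∈ Icc (0 : ℝ) 1 := ⟨hx.1.1.trans hz.1, hz.2.trans hy.1.2⟩
    exact ⟨hz', hQ hx.1 hz' hz.1 hx.2⟩
  have hnull : ∀ᵐ s : ℝ, ∀ i, s ∉ frontier {t | t ∈ Icc (0 : ℝ) 1 ∧ i ∈ Q t} := by
    rw [ae_all_iff]
    intro i
    exact measure_eq_zero_iff_ae_notMem.1 ((hconv i).addHaar_frontier volume)
  filter_upwards [hnull] with s hs hs01
  have hev : ∀ i, ∀ᶠ r in 𝓝 s, (i ∈ Q r ↔ i ∈ Q s) := by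
    intro i
    have h01 : ∀ᶠ r in 𝓝 s, r ∈ Icc (0 : ℝ) 1 := Icc_mem_nhds hs01.1 hs01.2
    have hsI : s ∈ Icc (0 : ℝ) 1 := Ioo_subset_Icc_self hs01
    by_cases hi : i ∈ Q s
    · have : s ∈ interior {t | t ∈ Icc (0 : ℝ) 1 ∧ i ∈ Q t} := by
        by_contra hcon
        exact hs i ⟨subset_closure ⟨hsI, hi⟩, hcon⟩
      filter_upwards [mem_interior_iff_mem_nhds.1 this] with r hr
      exact ⟨fun _ => hi, fun _ => hr.2⟩
    · have : s ∉ closure {t | t ∈ Icc (0 : ℝ) 1 ∧ i ∈ Q t} := by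
        intro hcl
        exact hs i ⟨hcl, fun hint => hi (interior_subset hint).2⟩
      filter_upwards [isClosed_closure.isOpen_compl.mem_nhds this, h01] with r hr hr01
      exact ⟨fun h => (hr (subset_closure ⟨hr01, h⟩)).elim,
        fun h => absurd h hi⟩
  filter_upwards [eventually_all.2 hev] with r hr
  ext i
  exact hr i

/-! ### Absolutely continuous curves -/

theorem absolutelyContinuousOnInterval_of_dist_le {X Y : Type*} [PseudoMetricSpace X]
    [PseudoMetricSpace Y] {f : ℝ → X} {Φ : ℝ → Y} {a b c : ℝ}
    (hΦ : AbsolutelyContinuousOnInterval Φ a b)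
    (h : ∀ s ∈ uIcc a b, ∀ t ∈ uIcc a b, dist (f s) (f t) ≤ c * dist (Φ s) (Φ t)) :
    AbsolutelyContinuousOnInterval f a b := by
  unfold AbsolutelyContinuousOnInterval at hΦ ⊢
  have hlim := hΦ.const_mul c
  rw [mul_zero] at hlim
  refine squeeze_zero' (Eventually.of_forall fun I => Finset.sum_nonneg fun _ _ => dist_nonneg)
    ?_ hlim
  filter_upwards [mem_inf_of_right (mem_principal_self _)] with I hI
  rw [Finset.mul_sum]
  exact Finset.sum_le_sum fun i hi => h _ (hI.1 i hi).1 _ (hI.1 i hi).2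

theorem norm_sub_le_integral_deriv {f : ℝ → ℝ} (hf : AbsolutelyContinuousOnInterval f 0 1)
    {s t : ℝ} (hs : 0 ≤ s) (hst : s ≤ t) (ht : t ≤ 1) :
    |f t - f s| ≤ (∫ r in (0 : ℝ)..t, |deriv f r|) - ∫ r in (0 : ℝ)..s, |deriv f r| := by
  have hint : ∀ {p q : ℝ}, p ∈ Icc (0 : ℝ) 1 → q ∈ Icc (0 : ℝ) 1 →
      IntervalIntegrable (fun r => |deriv f r|) volume p q := by
    intro p q hp hq
    refine (hf.intervalIntegrable_deriv.abs).mono_set ?_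
    rw [uIcc_of_le zero_le_one]
    exact uIcc_subset_Icc hp hq
  have h0 : (0 : ℝ) ∈ Icc (0 : ℝ) 1 := by simp
  have hsm : s ∈ Icc (0 : ℝ) 1 := ⟨hs, hst.trans ht⟩
  have htm : t ∈ Icc (0 : ℝ) 1 := ⟨hs.trans hst, ht⟩
  rw [intervalIntegral.integral_interval_sub_left (hint h0 htm) (hint h0 hsm)]
  have hac : AbsolutelyContinuousOnInterval f s t := by
    refine hf.mono ?_
    rw [uIcc_of_le zero_le_one]
    exact uIcc_subset_Icc hsm htm
  rw [← hac.integral_deriv_eq_sub]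
  exact intervalIntegral.abs_integral_le_integral_abs hst

/-! ### Orthogonal projections with respect to degenerate forms -/

/-- Definiteness on `W` alone gives `W ∩ W^⊥ = 0`, which in finite dimension already makes `W^⊥` a
complement; `T` is the projection onto it along `W`. Definiteness on all of `X` would be too much,
since cells that miss `Ω` carry no elastic energy. -/
theorem exists_orthogonal_projection {X : Type*} [AddCommGroup X] [Module ℝ X]
    [FiniteDimensional ℝ X] (b : LinearMap.BilinForm ℝ X) (hb : b.IsSymm) (W : Submodule ℝ X)
    (hW : ∀ w ∈ W, b w w = 0 → w = 0) :
    ∃ T : X →ₗ[ℝ] X, (∀ x, x - T x ∈ W) ∧ ∀ x, ∀ w ∈ W, b w (T x) = 0 := by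
  have hdis : Disjoint W (b.orthogonal W) := by
    rw [Submodule.disjoint_def]
    intro w hw hwo
    exact hW w hw (hwo w hw)
  have hc := (LinearMap.BilinForm.isCompl_orthogonal_iff_disjoint hb.isRefl).2 hdis
  refine ⟨(b.orthogonal W).projection W hc.symm, fun x => Submodule.sub_projection_mem hc.symm x,
    fun x w hw => ?_⟩
  have := Submodule.projection_apply_mem hc.symm x
  exact this w hw

/-! ### Time grids -/

section TimeGrid

variable {σ : ℕ → ℝ} {m : ℕ} {s t : ℝ}

theorem stepIndex_le : stepIndex σ m t ≤ m := Nat.findGreatest_le m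

theorem stepIndex_spec (h0 : σ 0 ≤ t) : σ (stepIndex σ m t) ≤ t := by
  classical
  exact Nat.findGreatest_spec (P := fun k => σ k ≤ t) (Nat.zero_le m) h0

theorem stepIndex_mono (hst : s ≤ t) : stepIndex σ m s ≤ stepIndex σ m t := by
  classical
  exact Nat.findGreatest_mono (fun k hk => le_trans hk hst) le_rfl

theorem lt_of_stepIndex_lt (h : stepIndex σ m t < m) : t < σ (stepIndex σ m t + 1) := by
  classical
  have := Nat.findGreatest_is_greatest (P := fun k => σ k ≤ t) (Nat.lt_succ_self _) h
  exact not_le.1 this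

end TimeGrid

theorem IsTimeGrid.stepIndex_zero {τ : ℕ → ℕ → ℝ} (hτ : IsTimeGrid τ) (m : ℕ) :
    stepIndex (τ m) m 0 = 0 := by
  by_contra h
  have h1 := stepIndex_spec (σ := τ m) (m := m) (t := 0) (hτ.zero m).le
  have h2 := hτ.strictMono m 0 _ (Nat.pos_of_ne_zero h) stepIndex_le
  rw [hτ.zero] at h2
  exact absurd h1 (not_le.2 h2)

theorem IsTimeGrid.tendsto_stepIndex {τ : ℕ → ℕ → ℝ} (hτ : IsTimeGrid τ) {t : ℝ}
    (ht : t ∈ Icc (0 : ℝ) 1) :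
    Tendsto (fun m => τ m (stepIndex (τ m) m t)) atTop (𝓝 t) := by
  rw [Metric.tendsto_atTop]
  intro δ hδ
  obtain ⟨M, hM⟩ := hτ.step δ hδ
  -- The last grid point need not be `1`. A grid point near `1` survives in all finer grids by
  -- nestedness, which handles times beyond the last grid point.
  have h1 : (1 : ℝ) ∈ closure (⋃ m, τ m '' Iic m) := hτ.dense (by simp)
  obtain ⟨y, hy, hyd⟩ := Metric.mem_closure_iff.1 h1 δ hδ
  obtain ⟨m₀, hm₀⟩ := mem_iUnion.1 hy
  have hmem : ∀ m ≥ m₀, y ∈ τ m '' Iic m := by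
    intro m hm
    induction m, hm using Nat.le_induction with
    | base => exact hm₀
    | succ m _ ih => exact hτ.nested m ih
  refine ⟨max M m₀, fun m hm => ?_⟩
  have hle : τ m (stepIndex (τ m) m t) ≤ t := stepIndex_spec (by rw [hτ.zero]; exact ht.1)
  have hgt : t - δ < τ m (stepIndex (τ m) m t) := by
    rcases lt_or_eq_of_le (stepIndex_le (σ := τ m) (m := m) (t := t)) with hk | hk
    · have := hM m (le_trans (le_max_left _ _) hm) _ hk
      have := lt_of_stepIndex_lt hk
      linarith
    · rw [hk]
      obtain ⟨i, hi, rfl⟩ := hmem m (le_trans (le_max_right _ _) hm)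
      have hi' : i ≤ m := hi
      have : τ m i ≤ τ m m := by
        rcases hi'.lt_or_eq with h | h
        · exact (hτ.strictMono m i m h le_rfl).le
        · rw [h]
      rw [Real.dist_eq] at hyd
      have := (abs_lt.1 hyd).2
      linarith [ht.2]
  rw [Real.dist_eq, abs_lt]
  constructor <;> linarith

/-! ### The reduced evolution -/

section Reduced

variable {X ι : Type*} [NormedAddCommGroup X] [NormedSpace ℝ X]

/-- The energy as a function of the crack set and of the boundary data, after minimization in all
other variables; `T P` is the projection onto the equilibria for the crack set `P`. -/
def reducedEnergy (b : LinearMap.BilinForm ℝ X) (T : Set ι → X →ₗ[ℝ] X) (ν : Set ι → ℝ)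
    (P : Set ι) (x : X) : ℝ :=
  b (T P x) (T P x) + ν P

variable {b : LinearMap.BilinForm ℝ X} {T : Set ι → X →ₗ[ℝ] X} {ν : Set ι → ℝ}

theorem continuous_reducedEnergy [FiniteDimensional ℝ X] (P : Set ι) :
    Continuous (reducedEnergy b T ν P) := by
  have h : Continuous (T P) := (T P).continuous_of_finiteDimensional
  have hβ := (LinearMap.toContinuousBilinearMap b).continuous₂
  have := hβ.comp (h.prodMk h)
  exact this.add continuous_const

theorem exists_reducedEnergy_lipschitz [FiniteDimensional ℝ X] [Finite ι] (M : ℝ) :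
    ∃ c, 0 ≤ c ∧ ∀ (P : Set ι) (x y : X), ‖x‖ ≤ M → ‖y‖ ≤ M →
      |reducedEnergy b T ν P x - reducedEnergy b T ν P y| ≤ c * ‖x - y‖ := by
  let β := LinearMap.toContinuousBilinearMap b
  let N : Set ι → ℝ := fun P => ‖LinearMap.toContinuousLinearMap (T P)‖
  have hN : ∀ P x, ‖T P x‖ ≤ N P * ‖x‖ := fun P x =>
    (LinearMap.toContinuousLinearMap (T P)).le_opNorm x
  have hβ : ∀ x y, |b x y| ≤ ‖β‖ * ‖x‖ * ‖y‖ := fun x y => β.le_opNorm₂ x y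
  obtain ⟨N₀, hN₀⟩ := Finite.exists_le N
  have hN00 : 0 ≤ N₀ := (norm_nonneg _).trans (hN₀ ∅)
  -- The term `ν P` cancels, and `N₀` bounds all the finitely many `T P` at once. The `max` keeps
  -- the constant nonnegative.
  refine ⟨2 * ‖β‖ * N₀ * (N₀ * max M 0), by positivity, fun P x y hx hy => ?_⟩
  have hN' : ∀ x, ‖T P x‖ ≤ N₀ * ‖x‖ := fun x =>
    (hN P x).trans (mul_le_mul_of_nonneg_right (hN₀ P) (norm_nonneg _))
  have hid : reducedEnergy b T ν P x - reducedEnergy b T ν P y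
      = b (T P (x - y)) (T P x) + b (T P y) (T P (x - y)) := by
    simp only [reducedEnergy, map_sub, LinearMap.sub_apply]
    ring
  have hb1 : ∀ z, ‖z‖ ≤ M → ‖T P z‖ ≤ N₀ * max M 0 := fun z hz =>
    (hN' z).trans (mul_le_mul_of_nonneg_left (hz.trans (le_max_left _ _)) hN00)
  rw [hid]
  calc _ ≤ |b (T P (x - y)) (T P x)| + |b (T P y) (T P (x - y))| := abs_add_le _ _
    _ ≤ ‖β‖ * ‖T P (x - y)‖ * ‖T P x‖ + ‖β‖ * ‖T P y‖ * ‖T P (x - y)‖ :=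
        add_le_add (hβ _ _) (hβ _ _)
    _ ≤ ‖β‖ * (N₀ * ‖x - y‖) * (N₀ * max M 0) + ‖β‖ * (N₀ * max M 0) * (N₀ * ‖x - y‖) := by
        gcongr
        · exact hN' _
        · exact hb1 x hx
        · exact hb1 y hy
        · exact hN' _
    _ = _ := by ring

/-- The whole evolution at the level of crack sets. `Φ` is an increasing modulus for the data, so
that bounds on single time steps telescope. -/
theorem exists_reduced_evolution [FiniteDimensional ℝ X] [Finite ι] (hb : b.IsSymm) {R : Set ι}
    (hT : ∀ P ⊆ R, ∀ x y : X, b (x - T P x) (T P y) = 0)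
    {x : ℝ → X} {Φ : ℝ → ℝ} (hΦ : AbsolutelyContinuousOnInterval Φ 0 1)
    (hΦx : ∀ s t, 0 ≤ s → s ≤ t → t ≤ 1 → ‖x t - x s‖ ≤ Φ t - Φ s)
    (hxd : ∀ᵐ s : ℝ, s ∈ Ioo (0 : ℝ) 1 → DifferentiableAt ℝ x s)
    {τ : ℕ → ℕ → ℝ} (hτ : IsTimeGrid τ) {Q : ℕ → ℕ → Set ι} (hQR : ∀ m, ∀ k ≤ m, Q m k ⊆ R)
    (hQ : ∀ m, Monotone (Q m))
    (hstab : ∀ m, ∀ k ≤ m, ∀ P, Q m k ⊆ P → P ⊆ R →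
      reducedEnergy b T ν (Q m k) (x (τ m k)) ≤ reducedEnergy b T ν P (x (τ m k)))
    (hnext : ∀ m, ∀ k < m, reducedEnergy b T ν (Q m (k + 1)) (x (τ m (k + 1))) ≤
      reducedEnergy b T ν (Q m k) (x (τ m (k + 1)))) :
    ∃ (φ : ℕ → ℕ) (S : ℝ → Set ι), StrictMono φ ∧
      (∀ t ∈ Icc (0 : ℝ) 1, ∀ᶠ n in atTop, Q (φ n) (stepIndex (τ (φ n)) (φ n) t) = S t) ∧
      (∀ t ∈ Icc (0 : ℝ) 1, Tendsto (fun n => x (τ (φ n) (stepIndex (τ (φ n)) (φ n) t)))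
        atTop (𝓝 (x t))) ∧
      (∀ t ∈ Icc (0 : ℝ) 1, S t ⊆ R) ∧ MonotoneOn S (Icc 0 1) ∧
      (∀ t ∈ Icc (0 : ℝ) 1, ∀ P, S t ⊆ P → P ⊆ R →
        reducedEnergy b T ν (S t) (x t) ≤ reducedEnergy b T ν P (x t)) ∧
      AbsolutelyContinuousOnInterval (fun t => reducedEnergy b T ν (S t) (x t)) 0 1 ∧
      ∀ᵐ s : ℝ, s ∈ Ioo (0 : ℝ) 1 → HasDerivAt (fun t => reducedEnergy b T ν (S t) (x t))
        (2 * b (T (S s) (x s)) (deriv x s)) s := by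
  have hI : uIcc (0 : ℝ) 1 = Icc 0 1 := uIcc_of_le zero_le_one
  have hxdist : ∀ s ∈ Icc (0 : ℝ) 1, ∀ t ∈ Icc (0 : ℝ) 1, dist (x s) (x t) ≤ dist (Φ s) (Φ t) := by
    intro s hs t ht
    rcases le_total s t with h | h
    · rw [dist_comm, dist_eq_norm, dist_comm, Real.dist_eq]
      exact (hΦx s t hs.1 h ht.2).trans (le_abs_self _)
    · rw [dist_eq_norm, Real.dist_eq]
      exact (hΦx t s ht.1 h hs.2).trans (le_abs_self _)
  have hxac : AbsolutelyContinuousOnInterval x 0 1 :=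
    absolutelyContinuousOnInterval_of_dist_le (c := 1) hΦ (by rw [hI]; simpa using hxdist)
  have hxc : ContinuousOn x (Icc 0 1) := hI ▸ hxac.continuousOn
  have hΦc : ContinuousOn Φ (Icc 0 1) := hI ▸ hΦ.continuousOn
  obtain ⟨M, hM⟩ := hxac.exists_bound
  rw [hI] at hM
  obtain ⟨c, hc, hlip⟩ := exists_reducedEnergy_lipschitz (b := b) (T := T) (ν := ν) M
  have hle : ∀ m i j, i ≤ j → j ≤ m → τ m i ≤ τ m j := by
    intro m i j hij hj
    rcases hij.lt_or_eq with h | h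
    · exact (hτ.strictMono m i j h hj).le
    · rw [h]
  -- the discrete energies vary no more than the data
  have hstep : ∀ m, ∀ k < m, |reducedEnergy b T ν (Q m (k + 1)) (x (τ m (k + 1))) -
      reducedEnergy b T ν (Q m k) (x (τ m k))| ≤ c * (Φ (τ m (k + 1)) - Φ (τ m k)) := by
    intro m k hk
    have h0 := hτ.mem m k hk.le
    have h1 := hτ.mem m (k + 1) hk
    have hx := hΦx _ _ h0.1 (hle m k (k + 1) (Nat.le_succ k) hk) h1.2
    have hx' := mul_le_mul_of_nonneg_left hx hc
    -- Upper bound: keep the old crack at the new time (`hnext`). Lower bound: use the new crack as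
    -- competitor at the old time (`hstab`). In each case only the data change at fixed crack.
    have hup := hlip (Q m k) _ _ (hM _ h1) (hM _ h0)
    have hlo := hlip (Q m (k + 1)) _ _ (hM _ h1) (hM _ h0)
    have hs := hstab m k hk.le (Q m (k + 1)) (hQ m (Nat.le_succ k)) (hQR m _ hk)
    have hn := hnext m k hk
    rw [abs_le] at hup hlo ⊢
    constructor <;> linarith
  have hsum : ∀ m i j, i ≤ j → j ≤ m → |reducedEnergy b T ν (Q m j) (x (τ m j)) -
      reducedEnergy b T ν (Q m i) (x (τ m i))| ≤ c * (Φ (τ m j) - Φ (τ m i)) := by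
    intro m i j hij
    induction j, hij using Nat.le_induction with
    | base => simp
    | succ j _ ih =>
      intro hj
      have h1 := ih (Nat.le_of_succ_le hj)
      have h2 := hstep m j hj
      rw [abs_le] at h1 h2 ⊢
      constructor <;> linarith
  obtain ⟨φ, S, hφ, hS⟩ := exists_subseq_eventually_eq (Icc (0 : ℝ) 1)
    (fun m t => Q m (stepIndex (τ m) m t)) (fun m s _ t _ hst => hQ m (stepIndex_mono hst))
  have hτlim : ∀ t ∈ Icc (0 : ℝ) 1,
      Tendsto (fun n => τ (φ n) (stepIndex (τ (φ n)) (φ n) t)) atTop (𝓝[Icc 0 1] t) := by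
    intro t ht
    refine tendsto_nhdsWithin_iff.2 ⟨(hτ.tendsto_stepIndex ht).comp hφ.tendsto_atTop, ?_⟩
    exact Eventually.of_forall fun n => hτ.mem _ _ stepIndex_le
  have hxlim : ∀ t ∈ Icc (0 : ℝ) 1,
      Tendsto (fun n => x (τ (φ n) (stepIndex (τ (φ n)) (φ n) t))) atTop (𝓝 (x t)) :=
    fun t ht => (hxc t ht).tendsto.comp (hτlim t ht)
  have hΦlim : ∀ t ∈ Icc (0 : ℝ) 1,
      Tendsto (fun n => Φ (τ (φ n) (stepIndex (τ (φ n)) (φ n) t))) atTop (𝓝 (Φ t)) :=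
    fun t ht => (hΦc t ht).tendsto.comp (hτlim t ht)
  have hElim : ∀ t ∈ Icc (0 : ℝ) 1, Tendsto (fun n => reducedEnergy b T ν
      (Q (φ n) (stepIndex (τ (φ n)) (φ n) t)) (x (τ (φ n) (stepIndex (τ (φ n)) (φ n) t))))
      atTop (𝓝 (reducedEnergy b T ν (S t) (x t))) := by
    intro t ht
    refine (((continuous_reducedEnergy (S t)).tendsto _).comp (hxlim t ht)).congr' ?_
    filter_upwards [hS t ht] with n hn
    simp only [Function.comp_apply, hn]
  have hSR : ∀ t ∈ Icc (0 : ℝ) 1, S t ⊆ R := by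
    intro t ht
    obtain ⟨n, hn⟩ := (hS t ht).exists
    exact hn ▸ hQR _ _ stepIndex_le
  have hSmono : MonotoneOn S (Icc 0 1) := by
    intro s hs t ht hst
    obtain ⟨n, hn, hn'⟩ := ((hS s hs).and (hS t ht)).exists
    exact hn ▸ hn' ▸ hQ _ (stepIndex_mono hst)
  -- Discrete energies converge at every time, so this two-sided bound survives and no lower
  -- semicontinuity is needed.
  have hdist : ∀ s ∈ Icc (0 : ℝ) 1, ∀ t ∈ Icc (0 : ℝ) 1, s ≤ t →
      |reducedEnergy b T ν (S t) (x t) - reducedEnergy b T ν (S s) (x s)| ≤ c * (Φ t - Φ s) := by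
    intro s hs t ht hst
    refine le_of_tendsto_of_tendsto' ((hElim t ht).sub (hElim s hs)).abs
      (((hΦlim t ht).sub (hΦlim s hs)).const_mul c) fun n => ?_
    exact hsum _ _ _ (stepIndex_mono hst) stepIndex_le
  refine ⟨φ, S, hφ, hS, hxlim, hSR, hSmono, ?_, ?_, ?_⟩
  · intro t ht P hSP hPR
    refine le_of_tendsto_of_tendsto (hElim t ht)
      (((continuous_reducedEnergy P).tendsto _).comp (hxlim t ht)) ?_
    filter_upwards [hS t ht] with n hn
    exact hstab _ _ stepIndex_le P (hn ▸ hSP) hPR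
  · refine absolutelyContinuousOnInterval_of_dist_le (c := c) hΦ ?_
    rw [hI]
    intro s hs t ht
    rcases le_total s t with h | h
    · rw [dist_comm, Real.dist_eq, dist_comm, Real.dist_eq]
      exact (hdist s hs t ht h).trans (mul_le_mul_of_nonneg_left (le_abs_self _) hc)
    · rw [Real.dist_eq, Real.dist_eq]
      exact (hdist t ht s hs h).trans (mul_le_mul_of_nonneg_left (le_abs_self _) hc)
  · filter_upwards [hxd, ae_eventually_eq_of_monotoneOn S hSmono] with s hds hSs hs
    have hd := (hds hs).hasDerivAt
    have hTd : HasDerivAt (fun t => T (S s) (x t)) (T (S s) (deriv x s)) s :=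
      (LinearMap.toContinuousLinearMap (T (S s))).hasFDerivAt.comp_hasDerivAt s hd
    have hbd := (LinearMap.toContinuousBilinearMap b).hasDerivAt_of_bilinear
      (u := fun t => T (S s) (x t)) (v := fun t => T (S s) (x t)) (fun _ => hTd) (fun _ => hTd)
    -- Orthogonality replaces `T x'` by `x'` when paired with `T x`, so the two product-rule terms
    -- combine to `2 b(T x, x')`.
    have horth := hT (S s) (hSR s (Ioo_subset_Icc_self hs)) (deriv x s) (x s)
    have hval : b (T (S s) (x s)) (T (S s) (deriv x s)) + b (T (S s) (deriv x s)) (T (S s) (x s))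
        = 2 * b (T (S s) (x s)) (deriv x s) := by
      have h1 : b (T (S s) (x s)) (deriv x s) = b (deriv x s) (T (S s) (x s)) := hb.eq _ _
      have h2 : b (T (S s) (x s)) (T (S s) (deriv x s))
        = b (T (S s) (deriv x s)) (T (S s) (x s)) := hb.eq _ _
      rw [map_sub, LinearMap.sub_apply] at horth
      rw [h1, h2]
      linarith
    have hE : HasDerivAt (fun t => reducedEnergy b T ν (S s) (x t))
        (2 * b (T (S s) (x s)) (deriv x s)) s := by
      rw [← hval]
      exact hbd.add_const _
    refine hE.congr_of_eventuallyEq ?_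
    filter_upwards [hSs hs] with r hr
    rw [hr]

end Reduced

variable {d : ℕ} {K : Mesh d} {h : ℝ} {s t : Finset (E d)} {x y : E d}

/-! ### Geometry of the mesh -/

theorem convex_simplex (s : Finset (E d)) : Convex ℝ (simplex s) := convex_convexHull ℝ _

theorem isCompact_simplex (s : Finset (E d)) : IsCompact (simplex s) :=
  s.finite_toSet.isCompact_convexHull ℝ

theorem isClosed_simplex (s : Finset (E d)) : IsClosed (simplex s) := (isCompact_simplex s).isClosed

theorem subset_simplex (s : Finset (E d)) : (s : Set (E d)) ⊆ simplex s := subset_convexHull ℝ _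

theorem affineSpan_face_eq_top_iff (hs : s ∈ K.faces) :
    affineSpan ℝ (s : Set (E d)) = ⊤ ↔ s.card = d + 1 := by
  have := (K.indep hs).affineSpan_eq_top_iff_card_eq_finrank_add_one
  simpa using this

theorem interior_simplex_nonempty_iff (hs : s ∈ K.faces) :
    (interior (simplex s)).Nonempty ↔ s.card = d + 1 := by
  rw [simplex, interior_convexHull_nonempty_iff_affineSpan_eq_top, affineSpan_face_eq_top_iff hs]

theorem simplex_subset_closure_interior (hs : s ∈ K.faces) (hc : s.card = d + 1) :
    simplex s ⊆ closure (interior (simplex s)) := by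
  rw [(convex_simplex s).closure_interior_eq_closure_of_nonempty_interior
    ((interior_simplex_nonempty_iff hs).2 hc)]
  exact subset_closure

theorem interior_inter_nonempty (hs : s ∈ K.faces) (hc : s.card = d + 1) {U : Set (E d)}
    (hU : IsOpen U) (h : (simplex s ∩ U).Nonempty) : (interior (simplex s) ∩ U).Nonempty := by
  obtain ⟨x, hx, hxU⟩ := h
  have := mem_closure_iff.1 (simplex_subset_closure_interior hs hc hx) U hU hxU
  rwa [inter_comm] at this

/-- The points which do not lie on the boundary of any simplex of the mesh. -/
def regularPoints (K : Mesh d) : Set (E d) := {x | ∀ s ∈ K.faces, x ∉ frontier (simplex s)}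

theorem mem_interior_of_regular (hx : x ∈ regularPoints K) (hs : s ∈ K.faces)
    (h : x ∈ simplex s) : x ∈ interior (simplex s) := by
  by_contra hcon
  exact hx s hs ⟨subset_closure h, hcon⟩

theorem card_eq_of_regular (hx : x ∈ regularPoints K) (hs : s ∈ K.faces)
    (h : x ∈ simplex s) : s.card = d + 1 :=
  (interior_simplex_nonempty_iff hs).1 ⟨x, mem_interior_of_regular hx hs h⟩

/-- The common points of two simplices lie in the simplex of their common vertices. By regularity
this face is already full-dimensional, so it has as many vertices as each of the two. -/
theorem eq_of_regular (hx : x ∈ regularPoints K) (hs : s ∈ K.faces) (ht : t ∈ K.faces)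
    (hxs : x ∈ simplex s) (hxt : x ∈ simplex t) : s = t := by
  classical
  have hx' : x ∈ simplex (s ∩ t) := by
    have := K.inter_subset_convexHull hs ht ⟨hxs, hxt⟩
    rwa [← Finset.coe_inter] at this
  have hne : (s ∩ t).Nonempty := by
    rw [← Finset.coe_nonempty]
    exact convexHull_nonempty_iff.1 ⟨x, hx'⟩
  have hst := K.down_closed hs Finset.inter_subset_left hne
  have h1 := card_eq_of_regular hx hst hx'
  have h2 := Finset.eq_of_subset_of_card_le (Finset.inter_subset_left (s₁ := s) (s₂ := t))
    (by rw [h1, card_eq_of_regular hx hs hxs])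
  have h3 := Finset.eq_of_subset_of_card_le (Finset.inter_subset_right (s₁ := s) (s₂ := t))
    (by rw [h1, card_eq_of_regular hx ht hxt])
  exact h2.symm.trans h3

theorem IsTriangulation.countable_faces (hK : IsTriangulation K h) : K.faces.Countable := by
  have := hK.locallyFinite.countable_univ fun s =>
    (convexHull_nonempty_iff.2 (Finset.coe_nonempty.2 (K.nonempty_of_mem_faces s.2)))
  exact countable_coe_iff.1 (countable_univ_iff.1 this)

/-- Frontiers of convex sets are null and there are countably many faces. Lower-dimensional
simplices are their own frontier, so regular points avoid them as well. -/
theorem IsTriangulation.ae_regular (hK : IsTriangulation K h) :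
    ∀ᵐ x : E d, x ∈ regularPoints K := by
  rw [regularPoints]
  refine (ae_ball_iff hK.countable_faces).2 fun s _ => ?_
  exact measure_eq_zero_iff_ae_notMem.1 ((convex_simplex s).addHaar_frontier volume)

theorem IsTriangulation.dense_regular (hK : IsTriangulation K h) :
    Dense (regularPoints K) := Measure.dense_of_ae hK.ae_regular

theorem IsTriangulation.exists_cell (hK : IsTriangulation K h) {A : Set (E d)}
    (hx : x ∈ regularPoints K) (hxA : x ∈ A) : ∃ s ∈ cells K A, x ∈ interior (simplex s) := by
  have : x ∈ K.space := hK.covers ▸ mem_univ x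
  obtain ⟨s, hs, hxs⟩ := Geometry.SimplicialComplex.mem_space_iff.1 this
  exact ⟨s, ⟨hs, card_eq_of_regular hx hs hxs, x, hxs, hxA⟩, mem_interior_of_regular hx hs hxs⟩

theorem IsTriangulation.eq_of_interior (hK : IsTriangulation K h) (hs : s ∈ K.faces)
    (ht : t ∈ K.faces) (hxs : x ∈ interior (simplex s)) (hxt : x ∈ interior (simplex t)) :
    s = t := by
  obtain ⟨y, hy, hyr⟩ := hK.dense_regular.inter_open_nonempty _
    (isOpen_interior.inter isOpen_interior) ⟨x, hxs, hxt⟩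
  exact eq_of_regular hyr hs ht (interior_subset hy.1) (interior_subset hy.2)

theorem IsTriangulation.finite_cells (hK : IsTriangulation K h) {A : Set (E d)}
    (hA : Bornology.IsBounded A) : (cells K A).Finite := by
  have hf := hK.locallyFinite.finite_nonempty_inter_compact hA.isCompact_closure
  refine (hf.image Subtype.val).subset fun s hs => ?_
  obtain ⟨hs, -, x, hx, hxA⟩ := hs
  exact ⟨⟨s, hs⟩, ⟨x, hx, subset_closure hxA⟩, rfl⟩

theorem isClosed_biUnion_simplex {S : Set (Finset (E d))} (hS : S.Finite) :
    IsClosed (⋃ s ∈ S, simplex s) := hS.isClosed_biUnion fun s _ => isClosed_simplex s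

theorem isCompact_biUnion_simplex {S : Set (Finset (E d))} (hS : S.Finite) :
    IsCompact (⋃ s ∈ S, simplex s) := hS.isCompact_biUnion fun s _ => isCompact_simplex s

/-- Since `cells` contains only the `d`-dimensional simplices, covering is clear at regular points
only. These are dense in the open set, and a finite union of simplices is closed. -/
theorem IsTriangulation.subset_cellRegion (hK : IsTriangulation K h) {A : Set (E d)}
    (hA : Bornology.IsBounded A) (hAo : IsOpen A) : A ⊆ cellRegion K A := by
  have hcl : IsClosed (cellRegion K A) := isClosed_biUnion_simplex (hK.finite_cells hA)
  refine (hK.dense_regular.open_subset_closure_inter hAo).trans (hcl.closure_subset_iff.2 ?_)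
  rintro x ⟨hxA, hx⟩
  obtain ⟨s, hs, hxs⟩ := hK.exists_cell hx hxA
  exact mem_biUnion hs (interior_subset hxs)

/-- Points close to `x` share a simplex with `x`. -/
theorem IsTriangulation.eventually_exists_cell (hK : IsTriangulation K h) {A : Set (E d)}
    (hA : Bornology.IsBounded A) (hAo : IsOpen A) (hx : x ∈ A) :
    ∀ᶠ y in 𝓝 x, ∃ s ∈ cells K A, x ∈ simplex s ∧ y ∈ simplex s := by
  -- The finitely many cells missing `x` stay at a distance from it, so any cell containing a nearby
  -- point also contains `x`.
  have hcl : IsClosed (⋃ s ∈ {s ∈ cells K A | x ∉ simplex s}, simplex s) :=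
    isClosed_biUnion_simplex ((hK.finite_cells hA).subset (sep_subset _ _))
  have hxn : x ∉ ⋃ s ∈ {s ∈ cells K A | x ∉ simplex s}, simplex s := by
    intro hmem
    obtain ⟨s, hs, hxs⟩ := mem_iUnion₂.1 hmem
    exact hs.2 hxs
  filter_upwards [hcl.isOpen_compl.mem_nhds hxn, hAo.mem_nhds hx] with y hy hyA
  obtain ⟨s, hs, hys⟩ := mem_iUnion₂.1 (hK.subset_cellRegion hA hAo hyA)
  refine ⟨s, hs, ?_, hys⟩
  by_contra hxs
  exact hy (mem_biUnion (show s ∈ {s ∈ cells K A | x ∉ simplex s} from ⟨hs, hxs⟩) hys)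

theorem volume_cellRegion_lt_top (hK : IsTriangulation K h) {A : Set (E d)}
    (hA : Bornology.IsBounded A) : volume (cellRegion K A) < ⊤ :=
  (isCompact_biUnion_simplex (hK.finite_cells hA)).measure_lt_top

/-! ### Gradients of finite element functions -/

/-- The vector `c v` is the gradient of the barycentric coordinate of `v`. This makes the cell
gradient a linear function of the nodal values, meaningful for arbitrary functions. -/
theorem exists_nodal_gradient (hs : s ∈ K.faces) (hc : s.card = d + 1) :
    ∃ c : E d → E d, ∀ (a : E d →ᵃ[ℝ] ℝ) (w : E d),
      a.linear w = inner ℝ (∑ v ∈ s, a v • c v) w := by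
  classical
  let B : AffineBasis s ℝ (E d) := ⟨(↑), K.indep hs, by
    have := (affineSpan_face_eq_top_iff hs).2 hc
    simpa using this⟩
  have hB : ∀ v : s, B v = v := fun v => rfl
  let c₀ : s → E d := fun v => (InnerProductSpace.toDual ℝ (E d)).symm
    (LinearMap.toContinuousLinearMap (B.coord v).linear)
  have hc₀ : ∀ v w, inner ℝ (c₀ v) w = (B.coord v).linear w := by
    intro v w
    simp [c₀, InnerProductSpace.toDual_symm_apply]
  refine ⟨fun v => if hv : v ∈ s then c₀ ⟨v, hv⟩ else 0, fun a w => ?_⟩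
  have ha : ∀ q, a q = ∑ v : s, B.coord v q * a v := by
    intro q
    have h1 := B.affineCombination_coord_eq_self q
    have h2 := Finset.univ.map_affineCombination B (fun i => B.coord i q)
      (B.sum_coord_apply_eq_one q) a
    rw [h1, Finset.affineCombination_eq_linear_combination _ _ _ (B.sum_coord_apply_eq_one q)] at h2
    simpa [hB] using h2
  have hlin : a.linear w = ∑ v : s, (B.coord v).linear w * a v := by
    have hdiff : ∀ f : E d →ᵃ[ℝ] ℝ, f.linear w = f w - f 0 := fun f => by
      have := f.linearMap_vsub w 0
      simpa using this
    have h2 := fun v => hdiff (B.coord v)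
    rw [hdiff a, ha, ha 0, ← Finset.sum_sub_distrib]
    refine Finset.sum_congr rfl fun v _ => ?_
    rw [h2, sub_mul]
  rw [hlin, sum_inner, ← Finset.sum_coe_sort s]
  refine Finset.sum_congr rfl fun v _ => ?_
  simp only [inner_smul_left, Finset.coe_mem, dite_true, hc₀]
  simp [mul_comm]

open scoped Classical in
/-- The gradient on the simplex `s` of the affine interpolation of `u` at the vertices of `s`. -/
noncomputable def cellGrad (s : Finset (E d)) : (E d → ℝ) →ₗ[ℝ] E d :=
  if h : ∃ c : E d → E d, ∀ (a : E d →ᵃ[ℝ] ℝ) (w : E d),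
      a.linear w = inner ℝ (∑ v ∈ s, a v • c v) w
  then ∑ v ∈ s, (LinearMap.proj v).smulRight (h.choose v) else 0

theorem exists_cellGrad_eq (s : Finset (E d)) :
    ∃ c : E d → E d, ∀ u : E d → ℝ, cellGrad s u = ∑ v ∈ s, u v • c v := by
  by_cases h : ∃ c : E d → E d, ∀ (a : E d →ᵃ[ℝ] ℝ) (w : E d),
      a.linear w = inner ℝ (∑ v ∈ s, a v • c v) w
  · exact ⟨h.choose, fun u => by simp [cellGrad, dif_pos h, LinearMap.sum_apply]⟩
  · exact ⟨0, fun u => by simp [cellGrad, dif_neg h]⟩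

theorem linear_eq_inner_cellGrad (hs : s ∈ K.faces) (hc : s.card = d + 1) (a : E d →ᵃ[ℝ] ℝ)
    (w : E d) : a.linear w = inner ℝ (cellGrad s a) w := by
  have h := exists_nodal_gradient hs hc
  rw [h.choose_spec a w]
  simp [cellGrad, dif_pos h, LinearMap.sum_apply]

theorem cellGrad_congr {u v : E d → ℝ} (h : EqOn u v (simplex s)) :
    cellGrad s u = cellGrad s v := by
  obtain ⟨c, hc⟩ := exists_cellGrad_eq s
  rw [hc, hc]
  exact Finset.sum_congr rfl fun z hz => by rw [h (subset_simplex s hz)]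

section contFE

variable {D : Set (E d)} {u v : E d → ℝ}

theorem contFE.sub_eq_inner (hu : u ∈ contFE K D) (hs : s ∈ cells K D) (hx : x ∈ simplex s)
    (hy : y ∈ simplex s) : u y - u x = inner ℝ (cellGrad s u) (y - x) := by
  obtain ⟨a, ha⟩ := hu.2 s hs
  rw [ha hx, ha hy, cellGrad_congr ha, ← linear_eq_inner_cellGrad hs.1 hs.2.1, ← vsub_eq_sub y x,
    AffineMap.linearMap_vsub, vsub_eq_sub]

theorem contFE.hasGradientAt (hu : u ∈ contFE K D) (hs : s ∈ cells K D)
    (hx : x ∈ interior (simplex s)) : HasGradientAt u (cellGrad s u) x := by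
  have hlin := (((InnerProductSpace.toDual ℝ (E d) (cellGrad s u)).hasFDerivAt (x := x)).sub_const
    (InnerProductSpace.toDual ℝ (E d) (cellGrad s u) x)).const_add (u x)
  rw [hasGradientAt_iff_hasFDerivAt]
  refine hlin.congr_of_eventuallyEq ?_
  filter_upwards [mem_interior_iff_mem_nhds.1 hx] with y hy
  have := contFE.sub_eq_inner hu hs (interior_subset hx) hy
  rw [inner_sub_right] at this
  rw [InnerProductSpace.toDual_apply_apply, InnerProductSpace.toDual_apply_apply, ← this]
  ring

theorem contFE.gradient_eq (hu : u ∈ contFE K D) (hs : s ∈ cells K D)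
    (hx : x ∈ interior (simplex s)) : gradient u x = cellGrad s u :=
  (contFE.hasGradientAt hu hs hx).gradient

theorem contFE.add (hu : u ∈ contFE K D) (hv : v ∈ contFE K D) : u + v ∈ contFE K D := by
  refine ⟨hu.1.add hv.1, fun s hs => ?_⟩
  obtain ⟨a, ha⟩ := hu.2 s hs
  obtain ⟨b, hb⟩ := hv.2 s hs
  exact ⟨a + b, fun x hx => by simp [ha hx, hb hx]⟩

theorem contFE.smul (c : ℝ) (hu : u ∈ contFE K D) : c • u ∈ contFE K D := by
  refine ⟨hu.1.const_smul c, fun s hs => ?_⟩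
  obtain ⟨a, ha⟩ := hu.2 s hs
  exact ⟨c • a, fun x hx => by simp [ha hx]⟩

theorem contFE.sub (hu : u ∈ contFE K D) (hv : v ∈ contFE K D) : u - v ∈ contFE K D := by
  have := contFE.add hu (contFE.smul (-1) hv)
  simpa [sub_eq_add_neg] using this

end contFE

/-- The finite element functions which vanish outside the closure of `Ω`. -/
noncomputable def testSpace (K : Mesh d) (Ω Ω' : Set (E d)) : Submodule ℝ (E d → ℝ) where
  carrier := {v | v ∈ contFE K Ω' ∧ ∀ x ∈ Ω' \ closure Ω, v x = 0}
  add_mem' hu hv := ⟨contFE.add hu.1 hv.1, fun x hx => by simp [hu.2 x hx, hv.2 x hx]⟩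
  zero_mem' := ⟨⟨continuousOn_const, fun s _ => ⟨0, fun x _ => rfl⟩⟩, fun _ _ => rfl⟩
  smul_mem' c u hu := ⟨contFE.smul c hu.1, fun x hx => by simp [hu.2 x hx]⟩

/-- The piecewise constant gradient. -/
noncomputable def meshGrad (K : Mesh d) (D : Set (E d)) : (E d → ℝ) →ₗ[ℝ] (cells K D → E d) :=
  LinearMap.pi fun s => cellGrad (s : Finset (E d))

@[simp]
theorem meshGrad_apply (D : Set (E d)) (u : E d → ℝ) (s : cells K D) :
    meshGrad K D u s = cellGrad (s : Finset (E d)) u := rfl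

/-- Integrals of piecewise constant functions. -/
theorem IsTriangulation.setIntegral_eq_sum (hK : IsTriangulation K h) {Ω D : Set (E d)}
    [Fintype (cells K D)] (hΩ : IsOpen Ω) (hΩD : Ω ⊆ D) (hb : Bornology.IsBounded D) (f : E d → ℝ)
    (c : cells K D → ℝ)
    (hf : ∀ x ∈ regularPoints K, x ∈ Ω → ∀ s : cells K D, x ∈ interior (simplex s.1) → f x = c s) :
    ∫ x in Ω, f x = ∑ s, (volume (interior (simplex s.1) ∩ Ω)).toReal * c s := by
  have hfin : volume Ω ≠ ⊤ := ((hb.subset hΩD).measure_lt_top).ne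
  have hae : f =ᵐ[volume.restrict Ω]
      fun x => ∑ s : cells K D, (interior (simplex s.1)).indicator (fun _ => c s) x := by
    filter_upwards [ae_restrict_of_ae hK.ae_regular, ae_restrict_mem hΩ.measurableSet] with x hx hxΩ
    obtain ⟨s, hs, hxs⟩ := hK.exists_cell hx (hΩD hxΩ)
    rw [Finset.sum_eq_single (⟨s, hs⟩ : cells K D)]
    · rw [indicator_of_mem hxs]
      exact hf x hx hxΩ ⟨s, hs⟩ hxs
    · intro t _ hts
      refine indicator_of_notMem (fun hxt => hts (Subtype.ext ?_)) _
      exact hK.eq_of_interior t.2.1 hs.1 hxt hxs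
    · simp
  rw [integral_congr_ae hae, integral_finsetSum]
  · refine Finset.sum_congr rfl fun s _ => ?_
    rw [integral_indicator isOpen_interior.measurableSet, setIntegral_const, smul_eq_mul,
      Measure.real, Measure.restrict_apply isOpen_interior.measurableSet]
  · intro s _
    have : IsFiniteMeasure (volume.restrict Ω) := ⟨by simpa using hfin.lt_top⟩
    exact (integrable_const _).indicator isOpen_interior.measurableSet

/-! ### Piecewise constant fields and cracks -/

/-- A point in the interior of a non-degenerate simplex. -/
noncomputable def cellPoint (s : Finset (E d)) : E d :=
  Classical.epsilon fun x => x ∈ interior (simplex s)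

theorem cellPoint_mem {s : Finset (E d)} (hs : s ∈ K.faces) (hc : s.card = d + 1) :
    cellPoint s ∈ interior (simplex s) :=
  Classical.epsilon_spec ((interior_simplex_nonempty_iff hs).2 hc)

/-- The values of a piecewise constant field. -/
noncomputable def cellValue {D : Set (E d)} (γ : E d → E d) (s : cells K D) : E d :=
  γ (cellPoint s.1)

theorem constFE.eq_cellValue {D : Set (E d)} {γ : E d → E d} (hγ : γ ∈ constFE K D)
    (s : cells K D) (hx : x ∈ interior (simplex s.1)) : γ x = cellValue γ s := by
  obtain ⟨c, hc⟩ := hγ s.1 s.2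
  rw [hc x hx, cellValue, hc _ (cellPoint_mem s.2.1 s.2.2.1)]

/-- The cells on which `γ` does not vanish. -/
def crackCells (K : Mesh d) (D : Set (E d)) (γ : E d → E d) : Set (cells K D) :=
  {s | cellValue γ s ≠ 0}

/-- The union of a family of simplices. -/
def region {D : Set (E d)} (P : Set (cells K D)) : Set (E d) := ⋃ s ∈ P, simplex s.1

theorem support_eq_region {D : Set (E d)} {γ : E d → E d} (hγ : γ ∈ constFE K D) :
    support K D γ = region (crackCells K D γ) := by
  ext x
  simp only [support, region, mem_iUnion, exists_prop, crackCells, mem_ofPred_eq]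
  constructor
  · rintro ⟨s, ⟨hs, y, hy, hγy⟩, hx⟩
    exact ⟨⟨s, hs⟩, by rwa [← constFE.eq_cellValue hγ ⟨s, hs⟩ hy], hx⟩
  · rintro ⟨s, hs, hx⟩
    exact ⟨s.1, ⟨s.2, _, cellPoint_mem s.2.1 s.2.2.1, hs⟩, hx⟩

theorem region_mono {D : Set (E d)} {P Q : Set (cells K D)} (hPQ : P ⊆ Q) :
    region P ⊆ region Q := biUnion_subset_biUnion_left hPQ

theorem region_union {D : Set (E d)} (P Q : Set (cells K D)) :
    region (P ∪ Q) = region P ∪ region Q := biUnion_union P Q _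

@[simp]
theorem region_empty {D : Set (E d)} : region (∅ : Set (cells K D)) = ∅ := by simp [region]

theorem isCompact_region {D : Set (E d)} [Finite (cells K D)] (P : Set (cells K D)) :
    IsCompact (region P) :=
  (Set.toFinite P).isCompact_biUnion fun s _ => isCompact_simplex s.1

theorem mem_region_iff_of_interior {D : Set (E d)}
    {P : Set (cells K D)} {s : cells K D} (hxr : x ∈ regularPoints K)
    (hx : x ∈ interior (simplex s.1)) : x ∈ region P ↔ s ∈ P := by
  constructor
  · intro hxP
    obtain ⟨t, ht, hxt⟩ := mem_iUnion₂.1 hxP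
    have := eq_of_regular hxr t.2.1 s.2.1 hxt (interior_subset hx)
    rwa [Subtype.ext this] at ht
  · exact fun hs => mem_biUnion hs (interior_subset hx)

/-- The crack energy. -/
noncomputable def crackEnergy {D : Set (E d)} (κ ε : ℝ) (P : Set (cells K D)) : ℝ :=
  κ / (2 * ε) * (volume (meshNhd K ε (region P))).toReal

theorem meshNhd_mono {ε : ℝ} {A B : Set (E d)} (hAB : A ⊆ B) : meshNhd K ε A ⊆ meshNhd K ε B := by
  refine biUnion_subset_biUnion_left fun s hs => ⟨hs.1, hs.2.1, hs.2.2.mono ?_⟩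
  exact inter_subset_inter_right _ (Metric.cthickening_subset_of_subset ε hAB)

theorem crackEnergy_mono (hK : IsTriangulation K h) {D : Set (E d)} [Finite (cells K D)]
    {κ ε : ℝ} (hκ : 0 < κ) (hε : 0 < ε) {P Q : Set (cells K D)} (hPQ : P ⊆ Q) :
    crackEnergy κ ε P ≤ crackEnergy κ ε Q := by
  refine mul_le_mul_of_nonneg_left ?_ (by positivity)
  refine ENNReal.toReal_mono ?_ (measure_mono (meshNhd_mono (region_mono hPQ)))
  exact (volume_cellRegion_lt_top hK ((isCompact_region Q).isBounded.cthickening)).ne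

theorem region_subset_meshNhd {D : Set (E d)} {ε : ℝ}
    (P : Set (cells K D)) : region P ⊆ meshNhd K ε (region P) := by
  intro x hx
  obtain ⟨s, hs, hxs⟩ := mem_iUnion₂.1 hx
  exact mem_biUnion (show s.1 ∈ cells K _ from
    ⟨s.2.1, s.2.2.1, x, hxs, Metric.self_subset_cthickening _ hx⟩) hxs

/-! ### The elastic energy -/

/-- The bilinear form `F ↦ F ⋅ C G`. -/
noncomputable def formBilin (C : Matrix (Fin d) (Fin d) ℝ) : LinearMap.BilinForm ℝ (E d) :=
  LinearMap.mk₂ ℝ (form C) (fun _ _ _ => by simp [form, add_dotProduct])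
    (fun _ _ _ => by simp [form]) (fun _ _ _ => by simp [form, Matrix.mulVec_add, dotProduct_add])
    (fun _ _ _ => by simp [form, Matrix.mulVec_smul])

@[simp]
theorem formBilin_apply (C : Matrix (Fin d) (Fin d) ℝ) (F G : E d) :
    formBilin C F G = form C F G := rfl

theorem form_comm {C : Matrix (Fin d) (Fin d) ℝ} (hC : C.IsSymm) (F G : E d) :
    form C F G = form C G F := by
  rw [form, form, Matrix.dotProduct_mulVec, ← Matrix.mulVec_transpose, hC.eq, dotProduct_comm]

/-- The weight of a cell in the elastic energy. -/
noncomputable def cellWeight (Ω : Set (E d)) (s : Finset (E d)) : ℝ :=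
  (volume (interior (simplex s) ∩ Ω)).toReal

theorem cellWeight_nonneg (Ω : Set (E d)) (s : Finset (E d)) : 0 ≤ cellWeight Ω s :=
  ENNReal.toReal_nonneg

/-- The bilinear form of the elastic energy of piecewise constant strains. -/
noncomputable def elasticForm (Ω : Set (E d)) {D : Set (E d)} [Fintype (cells K D)]
    (C : Matrix (Fin d) (Fin d) ℝ) : LinearMap.BilinForm ℝ (cells K D → E d) :=
  ∑ s : cells K D, cellWeight Ω s.1 •
    (formBilin C).compl₁₂ (LinearMap.proj s) (LinearMap.proj s)

theorem elasticForm_apply (Ω : Set (E d)) {D : Set (E d)} [Fintype (cells K D)]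
    (C : Matrix (Fin d) (Fin d) ℝ) (F G : cells K D → E d) :
    elasticForm Ω C F G = ∑ s : cells K D, cellWeight Ω s.1 * form C (F s) (G s) := by
  simp [elasticForm, LinearMap.sum_apply]

/-- The standing assumptions on the mesh, the domains and the material parameters. -/
structure IsSetting (K : Mesh d) (h : ℝ) (Ω Ω' : Set (E d)) (C : Matrix (Fin d) (Fin d) ℝ)
    (κ ε : ℝ) : Prop where
  mesh : IsTriangulation K h
  isOpen : IsOpen Ω
  isOpen' : IsOpen Ω'
  subset : Ω ⊆ Ω'
  bounded : Bornology.IsBounded Ω'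
  symm : C.IsSymm
  pos : ∀ F : E d, F ≠ 0 → 0 < form C F F
  κ_pos : 0 < κ
  ε_pos : 0 < ε

/-- The elastic strain `∇u - γ`. -/
noncomputable def strain (K : Mesh d) (D : Set (E d)) (u : E d → ℝ) (γ : E d → E d) :
    cells K D → E d :=
  fun s => cellGrad s.1 u - cellValue γ s

/-- The cells on which the eigenstrain may be active. -/
def freeCells (K : Mesh d) (Ω Ω' : Set (E d)) : Set (cells K Ω') :=
  {s | Disjoint (interior (simplex s.1)) (Ω' \ closure Ω)}

/-- The variations of strain at fixed boundary values when the cells in `P` are cracked. -/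
noncomputable def variations (Ω : Set (E d)) {Ω' : Set (E d)} (P : Set (cells K Ω')) :
    Submodule ℝ (cells K Ω' → E d) :=
  (testSpace K Ω Ω').map (meshGrad K Ω') ⊔ Submodule.pi Pᶜ fun _ => ⊥

/-- Fields living on `P` absorb everything there, so a variation is constrained only off `P`. -/
theorem mem_variations {Ω Ω' : Set (E d)} {P : Set (cells K Ω')} {F : cells K Ω' → E d} :
    F ∈ variations Ω P ↔ ∃ v ∈ testSpace K Ω Ω', ∀ s ∉ P, F s = cellGrad s.1 v := by
  rw [variations, Submodule.mem_sup]
  constructor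
  · rintro ⟨_, ⟨v, hv, rfl⟩, G, hG, rfl⟩
    refine ⟨v, hv, fun s hs => ?_⟩
    have : G s = 0 := by simpa using (Submodule.mem_pi.1 hG) s hs
    simp [this]
  · rintro ⟨v, hv, hF⟩
    refine ⟨_, ⟨v, hv, rfl⟩, F - meshGrad K Ω' v, ?_, by simp⟩
    rw [Submodule.mem_pi]
    intro s hs
    simp [hF s hs]

theorem variations_mono {Ω Ω' : Set (E d)} {P Q : Set (cells K Ω')} (hPQ : P ⊆ Q) :
    variations Ω P ≤ variations Ω Q := by
  intro F hF
  obtain ⟨v, hv, hF⟩ := mem_variations.1 hF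
  exact mem_variations.2 ⟨v, hv, fun s hs => hF s fun h => hs (hPQ h)⟩

namespace IsSetting

variable {Ω Ω' : Set (E d)} {C : Matrix (Fin d) (Fin d) ℝ} {κ ε : ℝ}

theorem finite_cells (hS : IsSetting K h Ω Ω' C κ ε) : (cells K Ω').Finite :=
  hS.mesh.finite_cells hS.bounded

theorem form_nonneg (hS : IsSetting K h Ω Ω' C κ ε) (F : E d) : 0 ≤ form C F F := by
  rcases eq_or_ne F 0 with rfl | hF
  · simp [form]
  · exact (hS.pos F hF).le

theorem elasticForm_isSymm [Fintype (cells K Ω')] (hS : IsSetting K h Ω Ω' C κ ε) :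
    (elasticForm (K := K) (D := Ω') Ω C).IsSymm := by
  refine ⟨fun F G => ?_⟩
  simp only [elasticForm_apply]
  exact Finset.sum_congr rfl fun s _ => by rw [form_comm hS.symm]

theorem elasticForm_nonneg [Fintype (cells K Ω')] (hS : IsSetting K h Ω Ω' C κ ε)
    (F : cells K Ω' → E d) : 0 ≤ elasticForm Ω C F F := by
  rw [elasticForm_apply]
  exact Finset.sum_nonneg fun s _ => mul_nonneg (cellWeight_nonneg Ω s.1) (hS.form_nonneg _)

theorem isOpen_outer (hS : IsSetting K h Ω Ω' C κ ε) : IsOpen (Ω' \ closure Ω) :=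
  hS.isOpen'.sdiff isClosed_closure

theorem disjoint_of_mem_freeCells (hS : IsSetting K h Ω Ω' C κ ε) {s : cells K Ω'}
    (hs : s ∈ freeCells K Ω Ω') : Disjoint (simplex s.1) (Ω' \ closure Ω) := by
  rw [disjoint_iff_inter_eq_empty, ← not_nonempty_iff_eq_empty]
  intro hne
  obtain ⟨x, hx⟩ := interior_inter_nonempty s.2.1 s.2.2.1 hS.isOpen_outer hne
  exact Set.disjoint_left.1 hs hx.1 hx.2

/-- A free cell may stick out of `Ω`. Its interior meets `Ω'` at a point that must lie in the
closure of `Ω`, hence meets the open set `Ω` itself. -/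
theorem cellWeight_pos (hS : IsSetting K h Ω Ω' C κ ε) {s : cells K Ω'}
    (hs : s ∈ freeCells K Ω Ω') : 0 < cellWeight Ω s.1 := by
  obtain ⟨x, hx, hx'⟩ := interior_inter_nonempty s.2.1 s.2.2.1 hS.isOpen' s.2.2.2
  have hxc : x ∈ closure Ω := by
    by_contra hcon
    exact Set.disjoint_left.1 hs hx ⟨hx', hcon⟩
  obtain ⟨y, hy, hyΩ⟩ := mem_closure_iff.1 hxc _ isOpen_interior hx
  refine ENNReal.toReal_pos ?_ ?_
  · exact ((isOpen_interior.inter hS.isOpen).measure_pos volume ⟨y, hy, hyΩ⟩).ne'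
  · exact ((hS.bounded.subset (inter_subset_right.trans hS.subset)).measure_lt_top).ne

theorem cellGrad_eq_zero (hS : IsSetting K h Ω Ω' C κ ε) {s : cells K Ω'}
    (hs : s ∉ freeCells K Ω Ω') {v : E d → ℝ} (hv : v ∈ testSpace K Ω Ω') :
    cellGrad s.1 v = 0 := by
  obtain ⟨x, hx, hx'⟩ := Set.not_disjoint_iff.1 hs
  rw [← contFE.gradient_eq hv.1 s.2 hx]
  have : v =ᶠ[𝓝 x] fun _ => (0 : ℝ) := by
    filter_upwards [hS.isOpen_outer.mem_nhds hx'] with y hy using hv.2 y hy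
  exact (((hasGradientAt_iff_hasFDerivAt.2 (by simpa using hasFDerivAt_const (0 : ℝ) x) :
    HasGradientAt (fun _ : E d => (0 : ℝ)) 0 x)).congr_of_eventuallyEq this).gradient

/-- Free cells have positive weight, so the form controls `F` on them. On the others, which are
uncracked, `F` is the gradient of a test function vanishing on an open part of the cell. -/
theorem elasticForm_definite [Fintype (cells K Ω')] (hS : IsSetting K h Ω Ω' C κ ε)
    {P : Set (cells K Ω')} (hP : P ⊆ freeCells K Ω Ω') {F : cells K Ω' → E d}
    (hF : F ∈ variations Ω P) (h0 : elasticForm Ω C F F = 0) : F = 0 := by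
  obtain ⟨v, hv, hF⟩ := mem_variations.1 hF
  rw [elasticForm_apply, Finset.sum_eq_zero_iff_of_nonneg fun s _ =>
    mul_nonneg (cellWeight_nonneg Ω s.1) (hS.form_nonneg _)] at h0
  funext s
  by_cases hs : s ∈ freeCells K Ω Ω'
  · by_contra hne
    exact (mul_pos (hS.cellWeight_pos hs) (hS.pos _ hne)).ne' (h0 s (Finset.mem_univ s))
  · rw [hF s fun h => hs (hP h), hS.cellGrad_eq_zero hs hv]
    rfl

/-- The projection onto the equilibrium strains for a given crack. -/
theorem exists_projection [Fintype (cells K Ω')] (hS : IsSetting K h Ω Ω' C κ ε) :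
    ∃ T : Set (cells K Ω') → (cells K Ω' → E d) →ₗ[ℝ] (cells K Ω' → E d),
      ∀ P ⊆ freeCells K Ω Ω', (∀ X, X - T P X ∈ variations Ω P) ∧
        ∀ X, ∀ F ∈ variations Ω P, elasticForm Ω C F (T P X) = 0 := by
  have := fun P (hP : P ⊆ freeCells K Ω Ω') => exists_orthogonal_projection
    (elasticForm (K := K) (D := Ω') Ω C) hS.elasticForm_isSymm (variations Ω P)
    fun F hF h0 => hS.elasticForm_definite hP hF h0
  choose! T hT using this
  exact ⟨T, hT⟩

end IsSetting

/-! ### Minimizers -/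

namespace IsSetting

variable {Ω Ω' : Set (E d)} {C : Matrix (Fin d) (Fin d) ℝ} {κ ε : ℝ} {g u : E d → ℝ}
  {γ : E d → E d} {P : Set (cells K Ω')} {p : (E d → ℝ) × (E d → E d)}

theorem strain_eq (hu : u ∈ contFE K Ω') (hγ : γ ∈ constFE K Ω') (s : cells K Ω')
    (hx : x ∈ interior (simplex s.1)) : gradient u x - γ x = strain K Ω' u γ s := by
  rw [contFE.gradient_eq hu s.2 hx, constFE.eq_cellValue hγ s hx, strain]

theorem energy_eq [Fintype (cells K Ω')] (hS : IsSetting K h Ω Ω' C κ ε) (hu : u ∈ contFE K Ω')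
    (hγ : γ ∈ constFE K Ω') (P : Set (cells K Ω')) :
    energy K Ω Ω' C κ ε u γ (region P) =
      elasticForm Ω C (strain K Ω' u γ) (strain K Ω' u γ) +
        crackEnergy κ ε (P ∪ crackCells K Ω' γ) := by
  rw [energy, support_eq_region hγ, ← region_union, crackEnergy, elasticForm_apply]
  congr 1
  exact hS.mesh.setIntegral_eq_sum hS.isOpen hS.subset hS.bounded _
    (fun s => form C (strain K Ω' u γ s) (strain K Ω' u γ s))
    fun x _ _ s hx => by rw [strain_eq hu hγ s hx]

theorem crackCells_subset (hp : p ∈ admissible K Ω Ω' g) :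
    crackCells K Ω' p.2 ⊆ freeCells K Ω Ω' := by
  intro s hs
  by_contra hcon
  obtain ⟨x, hx, hx'⟩ := Set.not_disjoint_iff.1 hcon
  apply hs
  rw [← constFE.eq_cellValue hp.2.1 s hx, (hp.2.2 x hx').2]

theorem sub_strain_mem (hg : g ∈ contFE K Ω') (hp : p ∈ admissible K Ω Ω' g) :
    meshGrad K Ω' g - strain K Ω' p.1 p.2 ∈ variations Ω (crackCells K Ω' p.2) := by
  refine mem_variations.2 ⟨g - p.1, ⟨contFE.sub hg hp.1, fun x hx => ?_⟩, fun s hs => ?_⟩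
  · simp [(hp.2.2 x hx).1]
  · have : cellValue p.2 s = 0 := not_not.1 hs
    simp [strain, this]

/-- Converse of `sub_strain_mem`: every strain in `X - variations P` is attained, so minimizing over
`(u, γ)` becomes minimizing over an affine space of strains. -/
theorem exists_admissible [Fintype (cells K Ω')] (hS : IsSetting K h Ω Ω' C κ ε)
    (hg : g ∈ contFE K Ω') (hP : P ⊆ freeCells K Ω Ω') {F : cells K Ω' → E d}
    (hF : meshGrad K Ω' g - F ∈ variations Ω P) :
    ∃ p ∈ admissible K Ω Ω' g, strain K Ω' p.1 p.2 = F ∧ crackCells K Ω' p.2 ⊆ P := by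
  obtain ⟨v, hv, hFv⟩ := mem_variations.1 hF
  -- The eigenstrain takes up what separates `∇(g - v)` from `F`; off `P` there is nothing left.
  let c : cells K Ω' → E d := fun s => cellGrad s.1 (g - v) - F s
  have hc : ∀ s ∉ P, c s = 0 := by
    intro s hs
    have h1 := hFv s hs
    rw [Pi.sub_apply, meshGrad_apply] at h1
    simp only [c, map_sub]
    rw [← h1]
    abel
  let γ : E d → E d := fun x =>
    ∑ s : cells K Ω', (interior (simplex s.1)).indicator (fun _ => c s) x
  have hγc : ∀ (s : cells K Ω'), ∀ x ∈ interior (simplex s.1), γ x = c s := by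
    intro s x hx
    simp only [γ]
    rw [Finset.sum_eq_single s, indicator_of_mem hx]
    · intro t _ hts
      refine indicator_of_notMem (fun hxt => hts (Subtype.ext ?_)) _
      exact hS.mesh.eq_of_interior t.2.1 s.2.1 hxt hx
    · simp
  have hval : ∀ s, cellValue γ s = c s := fun s => hγc s _ (cellPoint_mem s.2.1 s.2.2.1)
  refine ⟨(g - v, γ), ⟨contFE.sub hg hv.1, fun s hs => ⟨c ⟨s, hs⟩, hγc ⟨s, hs⟩⟩,
    fun x hx => ⟨?_, ?_⟩⟩, ?_, ?_⟩
  · simp [hv.2 x hx]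
  · refine Finset.sum_eq_zero fun s _ => ?_
    by_cases hxs : x ∈ interior (simplex s.1)
    · rw [indicator_of_mem hxs]
      exact hc s fun hs => Set.disjoint_left.1 (hP hs) hxs hx
    · exact indicator_of_notMem hxs _
  · funext s
    simp [strain, hval, c]
  · intro s hs
    by_contra hcon
    exact hs (by rw [hval, hc s hcon])

end IsSetting

/-- `T P` maps the strain of the boundary data to the equilibrium strain for the crack `P`. -/
def IsEquilibriumMap (Ω : Set (E d)) {Ω' : Set (E d)} [Fintype (cells K Ω')]
    (C : Matrix (Fin d) (Fin d) ℝ)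
    (T : Set (cells K Ω') → (cells K Ω' → E d) →ₗ[ℝ] (cells K Ω' → E d)) : Prop :=
  ∀ P ⊆ freeCells K Ω Ω', (∀ X, X - T P X ∈ variations Ω P) ∧
    ∀ X, ∀ F ∈ variations Ω P, elasticForm Ω C F (T P X) = 0

namespace IsSetting

variable {Ω Ω' : Set (E d)} [Fintype (cells K Ω')] {C : Matrix (Fin d) (Fin d) ℝ} {κ ε : ℝ}
  {g : E d → ℝ} {P Q : Set (cells K Ω')} {p : (E d → ℝ) × (E d → E d)}
  {T : Set (cells K Ω') → (cells K Ω' → E d) →ₗ[ℝ] (cells K Ω' → E d)}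

/-- Pythagoras: `F - T P X = (X - T P X) - (X - F)` is a variation, hence orthogonal to `T P X`. -/
theorem elasticForm_eq_add (hS : IsSetting K h Ω Ω' C κ ε) (hT : IsEquilibriumMap Ω C T)
    (hP : P ⊆ freeCells K Ω Ω') {X F : cells K Ω' → E d} (hF : X - F ∈ variations Ω P) :
    F - T P X ∈ variations Ω P ∧ elasticForm Ω C F F =
      elasticForm Ω C (T P X) (T P X) + elasticForm Ω C (F - T P X) (F - T P X) := by
  have hmem : F - T P X ∈ variations Ω P := by
    have := (variations Ω P).sub_mem ((hT P hP).1 X) hF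
    rwa [sub_sub_sub_cancel_left] at this
  refine ⟨hmem, ?_⟩
  have h0 := (hT P hP).2 X _ hmem
  have h1 : elasticForm Ω C (T P X) F = elasticForm Ω C F (T P X) :=
    hS.elasticForm_isSymm.eq _ _
  simp only [map_sub, LinearMap.sub_apply] at h0 ⊢
  linarith

theorem reducedEnergy_le (hS : IsSetting K h Ω Ω' C κ ε) (hT : IsEquilibriumMap Ω C T)
    (hP : P ⊆ freeCells K Ω Ω') (hg : g ∈ contFE K Ω') (hp : p ∈ admissible K Ω Ω' g) :
    reducedEnergy (elasticForm Ω C) T (crackEnergy κ ε) (P ∪ crackCells K Ω' p.2)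
      (meshGrad K Ω' g) ≤ energy K Ω Ω' C κ ε p.1 p.2 (region P) := by
  rw [hS.energy_eq hp.1 hp.2.1, reducedEnergy]
  have hmem := variations_mono (subset_union_right (s := P)) (sub_strain_mem hg hp)
  have := (hS.elasticForm_eq_add hT (union_subset hP (crackCells_subset hp)) hmem).2
  have h0 := hS.elasticForm_nonneg
    (strain K Ω' p.1 p.2 - T (P ∪ crackCells K Ω' p.2) (meshGrad K Ω' g))
  linarith

/-- The eigenstrain may vanish on part of `P`. With a smaller pre-existing crack `Q` the crack
energy can therefore drop below that of `P`, whence an inequality for `Q` and equality only for `P`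
itself. -/
theorem exists_equilibrium (hS : IsSetting K h Ω Ω' C κ ε) (hT : IsEquilibriumMap Ω C T)
    (hP : P ⊆ freeCells K Ω Ω') (hg : g ∈ contFE K Ω') :
    ∃ p ∈ admissible K Ω Ω' g, strain K Ω' p.1 p.2 = T P (meshGrad K Ω' g) ∧
      crackCells K Ω' p.2 ⊆ P ∧ (∀ Q ⊆ P, energy K Ω Ω' C κ ε p.1 p.2 (region Q) ≤
        reducedEnergy (elasticForm Ω C) T (crackEnergy κ ε) P (meshGrad K Ω' g)) ∧
      energy K Ω Ω' C κ ε p.1 p.2 (region P) =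
        reducedEnergy (elasticForm Ω C) T (crackEnergy κ ε) P (meshGrad K Ω' g) := by
  obtain ⟨p, hp, hpT, hpP⟩ := hS.exists_admissible hg hP ((hT P hP).1 (meshGrad K Ω' g))
  refine ⟨p, hp, hpT, hpP, fun Q hQ => ?_, ?_⟩
  · rw [hS.energy_eq hp.1 hp.2.1, reducedEnergy, hpT]
    have := crackEnergy_mono hS.mesh hS.κ_pos hS.ε_pos (union_subset hQ hpP)
    linarith
  · rw [hS.energy_eq hp.1 hp.2.1, reducedEnergy, hpT, union_eq_self_of_subset_right hpP]

/-- A sandwich: Pythagoras bounds the energy of `p` below by the reduced energy at `Q`, and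
minimality bounds it above by that at every `P' ⊇ P`. Taking `P' = Q` forces equality, so the
remainder in Pythagoras vanishes and definiteness identifies the strain. -/
theorem minimizer_characterization (hS : IsSetting K h Ω Ω' C κ ε)
    (hT : IsEquilibriumMap Ω C T) (hP : P ⊆ freeCells K Ω Ω') (hg : g ∈ contFE K Ω')
    (hp : p ∈ admissible K Ω Ω' g) (hmin : ∀ q ∈ admissible K Ω Ω' g,
      energy K Ω Ω' C κ ε p.1 p.2 (region P) ≤ energy K Ω Ω' C κ ε q.1 q.2 (region P))
    (hQ : Q = P ∪ crackCells K Ω' p.2) :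
    strain K Ω' p.1 p.2 = T Q (meshGrad K Ω' g) ∧
      energy K Ω Ω' C κ ε p.1 p.2 (region Q) =
        reducedEnergy (elasticForm Ω C) T (crackEnergy κ ε) Q (meshGrad K Ω' g) ∧
      ∀ P', P ⊆ P' → P' ⊆ freeCells K Ω Ω' →
        reducedEnergy (elasticForm Ω C) T (crackEnergy κ ε) Q (meshGrad K Ω' g) ≤
          reducedEnergy (elasticForm Ω C) T (crackEnergy κ ε) P' (meshGrad K Ω' g) := by
  have hQR : Q ⊆ freeCells K Ω Ω' := hQ ▸ union_subset hP (crackCells_subset hp)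
  have hle := hS.reducedEnergy_le hT hP hg hp
  rw [← hQ] at hle
  have hge : ∀ P', P ⊆ P' → P' ⊆ freeCells K Ω Ω' → energy K Ω Ω' C κ ε p.1 p.2 (region P) ≤
      reducedEnergy (elasticForm Ω C) T (crackEnergy κ ε) P' (meshGrad K Ω' g) := by
    intro P' hPP' hP'
    obtain ⟨q, hq, -, -, hqe, -⟩ := hS.exists_equilibrium (κ := κ) (ε := ε) hT hP' hg
    exact (hmin q hq).trans (hqe P hPP')
  have hPQ : P ⊆ Q := hQ ▸ subset_union_left
  have heq := le_antisymm hle (hge Q hPQ hQR)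
  have hAQ : crackCells K Ω' p.2 ⊆ Q := hQ ▸ subset_union_right
  have hmem := variations_mono hAQ (sub_strain_mem hg hp)
  obtain ⟨hd, hadd⟩ := hS.elasticForm_eq_add hT hQR hmem
  have hstrain : strain K Ω' p.1 p.2 = T Q (meshGrad K Ω' g) := by
    rw [hS.energy_eq hp.1 hp.2.1, ← hQ, reducedEnergy] at heq
    exact sub_eq_zero.1 (hS.elasticForm_definite hQR hd (by linarith))
  refine ⟨hstrain, ?_, fun P' h1 h2 => hle.trans (hge P' h1 h2)⟩
  rw [hS.energy_eq hp.1 hp.2.1, reducedEnergy, hstrain, union_eq_self_of_subset_right hAQ]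

theorem exists_minimizer (hS : IsSetting K h Ω Ω' C κ ε)
    (hP : P ⊆ freeCells K Ω Ω') (hg : g ∈ contFE K Ω') :
    ∃ p ∈ admissible K Ω Ω' g, ∀ q ∈ admissible K Ω Ω' g,
      energy K Ω Ω' C κ ε p.1 p.2 (region P) ≤ energy K Ω Ω' C κ ε q.1 q.2 (region P) := by
  obtain ⟨T, hT⟩ := hS.exists_projection
  obtain ⟨Q, ⟨hPQ, hQ⟩, hQmin⟩ := Set.exists_min_image {Q | P ⊆ Q ∧ Q ⊆ freeCells K Ω Ω'}
    (fun Q => reducedEnergy (elasticForm Ω C) T (crackEnergy κ ε) Q (meshGrad K Ω' g))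
    (Set.toFinite _) ⟨P, Subset.rfl, hP⟩
  obtain ⟨p, hp, -, -, hpe, -⟩ := hS.exists_equilibrium (κ := κ) (ε := ε) hT hQ hg
  refine ⟨p, hp, fun q hq => (hpe P hPQ).trans ?_⟩
  exact (hQmin _ ⟨subset_union_left, union_subset hP (crackCells_subset hq)⟩).trans
    (hS.reducedEnergy_le hT hP hg hq)

end IsSetting

/-! ### Solvability of the incremental problems -/

/-- The cells that are cracked up to the `k`-th step. -/
def accumulatedCells (K : Mesh d) (D : Set (E d)) (γ : ℕ → E d → E d) (k : ℕ) :
    Set (cells K D) := ⋃ j ∈ Iic k, crackCells K D (γ j)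

theorem accumulatedCells_zero (D : Set (E d)) (γ : ℕ → E d → E d) :
    accumulatedCells K D γ 0 = crackCells K D (γ 0) := by
  simp [accumulatedCells]

theorem accumulatedCells_succ (D : Set (E d)) (γ : ℕ → E d → E d) (k : ℕ) :
    accumulatedCells K D γ (k + 1) = accumulatedCells K D γ k ∪ crackCells K D (γ (k + 1)) := by
  ext s
  simp only [accumulatedCells, mem_iUnion, mem_Iic, exists_prop, mem_union]
  constructor
  · rintro ⟨j, hj, hs⟩
    rcases Nat.le_succ_iff.1 hj with hj | rfl
    · exact Or.inl ⟨j, hj, hs⟩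
    · exact Or.inr hs
  · rintro (⟨j, hj, hs⟩ | hs)
    · exact ⟨j, hj.trans (Nat.le_succ k), hs⟩
    · exact ⟨k + 1, le_rfl, hs⟩

theorem accumulatedCells_mono (D : Set (E d)) (γ : ℕ → E d → E d) :
    Monotone (accumulatedCells K D γ) := fun _ _ hkl =>
  biUnion_subset_biUnion_left (Iic_subset_Iic.2 hkl)

theorem discreteCrack_eq_region {D : Set (E d)} {γ : ℕ → E d → E d} {k : ℕ}
    (hγ : ∀ j ≤ k, γ j ∈ constFE K D) :
    discreteCrack K D γ k = region (accumulatedCells K D γ k) := by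
  rw [discreteCrack, accumulatedCells, region]
  simp only [biUnion_iUnion]
  exact iUnion₂_congr fun j hj => support_eq_region (hγ j hj)

theorem IsSetting.exists_discreteSolution {Ω Ω' : Set (E d)} {C : Matrix (Fin d) (Fin d) ℝ}
    {κ ε : ℝ} (hS : IsSetting K h Ω Ω' C κ ε) {g : ℝ → E d → ℝ} {σ : ℕ → ℝ} {m : ℕ}
    (hg : ∀ k ≤ m, g (σ k) ∈ contFE K Ω') :
    ∃ (u : ℕ → E d → ℝ) (γ : ℕ → E d → E d), IsDiscreteSolution K Ω Ω' C κ ε g σ m u γ := by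
  have := hS.finite_cells.fintype
  -- The hypotheses sit inside the existential so that choice gives a total function, usable in a
  -- recursion.
  have hex : ∀ (k : ℕ) (P : Set (cells K Ω')), ∃ p : (E d → ℝ) × (E d → E d), k ≤ m →
      P ⊆ freeCells K Ω Ω' → p ∈ admissible K Ω Ω' (g (σ k)) ∧
        ∀ q ∈ admissible K Ω Ω' (g (σ k)),
          energy K Ω Ω' C κ ε p.1 p.2 (region P) ≤ energy K Ω Ω' C κ ε q.1 q.2 (region P) := by
    intro k P
    by_cases hk : k ≤ m ∧ P ⊆ freeCells K Ω Ω'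
    · obtain ⟨p, hp⟩ := hS.exists_minimizer hk.2 (hg k hk.1)
      exact ⟨p, fun _ _ => hp⟩
    · exact ⟨(0, 0), fun h1 h2 => absurd ⟨h1, h2⟩ hk⟩
  choose F hF using hex
  -- `P k` is the crack before step `k`, so it corresponds to `accumulatedCells` at `k - 1`.
  let P : ℕ → Set (cells K Ω') := fun k =>
    Nat.rec ∅ (fun k P => P ∪ crackCells K Ω' (F k P).2) k
  have hP : ∀ k, P (k + 1) = P k ∪ crackCells K Ω' (F k (P k)).2 := fun _ => rfl
  have hPR : ∀ k ≤ m + 1, P k ⊆ freeCells K Ω Ω' := by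
    intro k
    induction k with
    | zero => exact fun _ => empty_subset _
    | succ k ih =>
      intro hk
      have hk' := ih (Nat.le_of_succ_le hk)
      rw [hP]
      exact union_subset hk'
        (IsSetting.crackCells_subset (hF k _ (Nat.le_of_succ_le_succ hk) hk').1)
  have hmem : ∀ k ≤ m, F k (P k) ∈ admissible K Ω Ω' (g (σ k)) := fun k hk =>
    (hF k _ hk (hPR k (Nat.le_succ_of_le hk))).1
  have hacc : ∀ k, accumulatedCells K Ω' (fun k => (F k (P k)).2) k = P (k + 1) := by
    intro k
    induction k with
    | zero =>
      rw [accumulatedCells_zero, hP]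
      exact (empty_union _).symm
    | succ k ih => rw [accumulatedCells_succ, ih, hP (k + 1)]
  refine ⟨fun k => (F k (P k)).1, fun k => (F k (P k)).2, hmem, fun q hq => ?_,
    fun i hi q hq => ?_⟩
  · have := (hF 0 (P 0) (Nat.zero_le m) (hPR 0 (Nat.zero_le _))).2 q hq
    have h0 : region (P 0) = ∅ := by rw [show P 0 = ∅ from rfl, region_empty]
    rwa [h0] at this
  · rw [discreteCrack_eq_region fun j hj => (hmem j (hj.trans hi.le)).2.1, hacc]
    exact (hF (i + 1) (P (i + 1)) hi (hPR (i + 1) (by omega))).2 q hq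

/-! ### The boundary data -/

theorem absolutelyContinuousOnInterval_sum {ι : Type*} (s : Finset ι) {f : ι → ℝ → ℝ} {a b : ℝ}
    (hf : ∀ i ∈ s, AbsolutelyContinuousOnInterval (f i) a b) :
    AbsolutelyContinuousOnInterval (fun t => ∑ i ∈ s, f i t) a b := by
  classical
  induction s using Finset.induction_on with
  | empty =>
    simpa using (LipschitzWith.const (0 : ℝ)).lipschitzOnWith.absolutelyContinuousOnInterval
  | insert i s hi ih =>
    simp only [Finset.sum_insert hi]
    exact (hf i (Finset.mem_insert_self i s)).fun_add
      (ih fun j hj => hf j (Finset.mem_insert_of_mem hj))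

theorem vertex_mem_cellRegion {D : Set (E d)} (s : cells K D) {v : E d} (hv : v ∈ s.1) :
    v ∈ cellRegion K D := mem_biUnion s.2 (subset_simplex s.1 hv)

section Data

variable {D : Set (E d)} [Fintype (cells K D)] {g : ℝ → E d → ℝ}

theorem sobolevCurves.exists_modulus (hg : g ∈ sobolevCurves K D) :
    ∃ Φ : ℝ → ℝ, AbsolutelyContinuousOnInterval Φ 0 1 ∧ ∀ s t, 0 ≤ s → s ≤ t → t ≤ 1 →
      ‖meshGrad K D (g t) - meshGrad K D (g s)‖ ≤ Φ t - Φ s := by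
  choose c hc using fun s : cells K D => exists_cellGrad_eq s.1
  let V : E d → ℝ → ℝ := fun v t => ∫ r in (0 : ℝ)..t, |deriv (fun r => g r v) r|
  have hac := fun (s : cells K D) v (hv : v ∈ s.1) => hg.2 v (vertex_mem_cellRegion s hv)
  -- Weighted nodal variations are summed over all cells; each summand is nondecreasing, so the sum
  -- dominates every component of the supremum norm.
  refine ⟨fun t => ∑ s : cells K D, ∑ v ∈ s.1, ‖c s v‖ * V v t, ?_, ?_⟩
  · refine absolutelyContinuousOnInterval_sum _ fun s _ =>
      absolutelyContinuousOnInterval_sum _ fun v hv => ?_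
    exact ((hac s v hv).intervalIntegrable_deriv.abs
      |>.absolutelyContinuousOnInterval_intervalIntegral (by simp)).const_mul _
  · intro r t hr hrt ht
    have hterm : ∀ s : cells K D, ∀ v ∈ s.1,
        |g t v - g r v| * ‖c s v‖ ≤ ‖c s v‖ * V v t - ‖c s v‖ * V v r := by
      intro s v hv
      rw [← mul_sub, mul_comm]
      exact mul_le_mul_of_nonneg_left (norm_sub_le_integral_deriv (hac s v hv) hr hrt ht)
        (norm_nonneg _)
    simp only [← Finset.sum_sub_distrib]
    have hnn : ∀ s : cells K D, 0 ≤ ∑ v ∈ s.1, (‖c s v‖ * V v t - ‖c s v‖ * V v r) := fun s =>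
      Finset.sum_nonneg fun v hv => le_trans (by positivity) (hterm s v hv)
    refine (pi_norm_le_iff_of_nonneg (Finset.sum_nonneg fun s _ => hnn s)).2 fun s => ?_
    refine le_trans ?_ (Finset.single_le_sum (fun s _ => hnn s) (Finset.mem_univ s))
    rw [Pi.sub_apply, meshGrad_apply, meshGrad_apply, hc, hc, ← Finset.sum_sub_distrib]
    refine norm_sum_le_of_le _ fun v hv => ?_
    rw [← sub_smul, norm_smul, Real.norm_eq_abs]
    exact hterm s v hv

theorem sobolevCurves.ae_differentiableAt (hg : g ∈ sobolevCurves K D) :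
    ∀ᵐ s : ℝ, s ∈ Ioo (0 : ℝ) 1 → DifferentiableAt ℝ (fun t => meshGrad K D (g t)) s := by
  have hall : ∀ᵐ r : ℝ, ∀ s : cells K D, ∀ v ∈ s.1, r ∈ uIcc (0 : ℝ) 1 →
      DifferentiableAt ℝ (fun t => g t v) r := by
    refine ae_all_iff.2 fun s => (ae_ball_iff s.1.countable_toSet).2 fun v hv => ?_
    exact (hg.2 v (vertex_mem_cellRegion s hv)).ae_differentiableAt
  filter_upwards [hall] with r hr hr01
  rw [uIcc_of_le zero_le_one] at hr
  refine differentiableAt_pi.2 fun s => ?_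
  obtain ⟨c, hc⟩ := exists_cellGrad_eq s.1
  simp only [meshGrad_apply, hc]
  exact DifferentiableAt.fun_sum fun v hv =>
    (hr s v hv (Ioo_subset_Icc_self hr01)).smul_const _

end Data

theorem IsSetting.power_eq {Ω Ω' : Set (E d)} [Fintype (cells K Ω')]
    {C : Matrix (Fin d) (Fin d) ℝ} {κ ε : ℝ} (hS : IsSetting K h Ω Ω' C κ ε)
    {g u : ℝ → E d → ℝ} {γ : ℝ → E d → E d} {s : ℝ} (hs : s ∈ Ioo (0 : ℝ) 1)
    (hg : ∀ t ∈ Icc (0 : ℝ) 1, g t ∈ contFE K Ω') (hu : u s ∈ contFE K Ω')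
    (hγ : γ s ∈ constFE K Ω') (hd : DifferentiableAt ℝ (fun t => meshGrad K Ω' (g t)) s) :
    power Ω C g u γ s = elasticForm Ω C (strain K Ω' (u s) (γ s))
      (deriv (fun t => meshGrad K Ω' (g t)) s) := by
  rw [elasticForm_apply, power]
  refine hS.mesh.setIntegral_eq_sum hS.isOpen hS.subset hS.bounded _
    (fun σ => form C (strain K Ω' (u s) (γ s) σ) (deriv (fun t => meshGrad K Ω' (g t)) s σ))
    fun x _ _ σ hx => ?_
  rw [IsSetting.strain_eq hu hγ σ hx]
  congr 1
  have h1 := (hasDerivAt_pi.1 hd.hasDerivAt σ)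
  refine (h1.congr_of_eventuallyEq ?_).deriv
  filter_upwards [Icc_mem_nhds hs.1 hs.2] with r hr
  rw [contFE.gradient_eq (hg r hr) σ.2 hx, meshGrad_apply]

/-! ### Convergence of displacements away from the crack -/

theorem tendsto_eLpNorm_zero_of_uniform {α F : Type*} [MeasurableSpace α] [NormedAddCommGroup F]
    {μ : Measure α} [IsFiniteMeasure μ] {f : ℕ → α → F} {p : ENNReal}
    (hf : ∀ δ > 0, ∀ᶠ n in atTop, ∀ᵐ x ∂μ, ‖f n x‖ ≤ δ) :
    Tendsto (fun n => eLpNorm (f n) p μ) atTop (𝓝 0) := by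
  rw [ENNReal.tendsto_nhds_zero]
  intro η hη
  have hlim : Tendsto (fun δ : ℝ => μ univ ^ p.toReal⁻¹ * ENNReal.ofReal δ) (𝓝[>] 0) (𝓝 0) := by
    have h1 : Tendsto (fun δ : ℝ => ENNReal.ofReal δ) (𝓝[>] 0) (𝓝 (ENNReal.ofReal 0)) :=
      (ENNReal.continuous_ofReal.tendsto 0).mono_left nhdsWithin_le_nhds
    have h2 := ENNReal.Tendsto.const_mul (a := μ univ ^ p.toReal⁻¹) h1
      (Or.inr (ENNReal.rpow_ne_top_of_nonneg (by positivity) (measure_ne_top μ univ)))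
    simpa using h2
  obtain ⟨δ, hδη, hδ⟩ := ((ENNReal.tendsto_nhds_zero.1 hlim η hη).and self_mem_nhdsWithin).exists
  filter_upwards [hf δ hδ] with n hn
  exact (eLpNorm_le_of_ae_bound hn).trans hδη

namespace IsSetting

variable {Ω Ω' : Set (E d)} {C : Matrix (Fin d) (Fin d) ℝ} {κ ε : ℝ}
  {P : Set (cells K Ω')} {v : ℕ → E d → ℝ}

/-- The open set of which `goodSet` is a union of components. -/
theorem isOpen_uncracked [Fintype (cells K Ω')] (hS : IsSetting K h Ω Ω' C κ ε)
    (P : Set (cells K Ω')) :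
    IsOpen ((Ω' \ meshNhd K ε (region P)) ∪ (Ω' \ closure Ω)) := by
  refine (hS.isOpen'.sdiff (isClosed_biUnion_simplex (hS.mesh.finite_cells ?_))).union
    hS.isOpen_outer
  exact (isCompact_region P).isBounded.cthickening

theorem notMem_of_uncracked (hS : IsSetting K h Ω Ω' C κ ε) (hP : P ⊆ freeCells K Ω Ω')
    (hx : x ∈ (Ω' \ meshNhd K ε (region P)) ∪ (Ω' \ closure Ω)) {s : cells K Ω'}
    (hxs : x ∈ simplex s.1) : s ∉ P := by
  intro hs
  rcases hx with hx | hx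
  · exact hx.2 (region_subset_meshNhd P (mem_biUnion hs hxs))
  · exact Set.disjoint_left.1 (hS.disjoint_of_mem_freeCells (hP hs)) hxs hx

theorem tendsto_iff_of_mem_simplex (hv : ∀ n, v n ∈ contFE K Ω') {s : cells K Ω'}
    (hs : Tendsto (fun n => cellGrad s.1 (v n)) atTop (𝓝 0))
    (hx : x ∈ simplex s.1) (hy : y ∈ simplex s.1)
    (hvx : Tendsto (fun n => v n x) atTop (𝓝 0)) : Tendsto (fun n => v n y) atTop (𝓝 0) := by
  have h1 := hvx.add (hs.inner (tendsto_const_nhds (x := y - x)) (𝕜 := ℝ))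
  rw [inner_zero_left, add_zero] at h1
  refine h1.congr fun n => ?_
  rw [← contFE.sub_eq_inner (hv n) s.2 hx hy]
  ring

/-- Nearby points of the uncracked set share an uncracked cell, where increments of `v n` are
gradients times a fixed vector and tend to zero. Convergence to zero is thus a locally constant
property, and it holds at the outer base point of each component. -/
theorem tendsto_of_mem_goodSet [Fintype (cells K Ω')] (hS : IsSetting K h Ω Ω' C κ ε)
    (hP : P ⊆ freeCells K Ω Ω') (hv : ∀ n, v n ∈ contFE K Ω')
    (hgrad : ∀ s ∉ P, Tendsto (fun n => cellGrad s.1 (v n)) atTop (𝓝 0))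
    (hout : ∀ x ∈ Ω' \ closure Ω, Tendsto (fun n => v n x) atTop (𝓝 0))
    (hx : x ∈ goodSet K Ω Ω' ε (region P)) : Tendsto (fun n => v n x) atTop (𝓝 0) := by
  obtain ⟨z, hz, hxz⟩ := mem_iUnion₂.1 hx
  set O := (Ω' \ meshNhd K ε (region P)) ∪ (Ω' \ closure Ω) with hO
  have hOo : IsOpen O := hS.isOpen_uncracked P
  have hOΩ : O ⊆ Ω' := union_subset sdiff_subset sdiff_subset
  have hloc : ∀ x ∈ O, ∀ᶠ y in 𝓝 x, (Tendsto (fun n => v n y) atTop (𝓝 0) ↔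
      Tendsto (fun n => v n x) atTop (𝓝 0)) := by
    intro x hx
    filter_upwards [hS.mesh.eventually_exists_cell hS.bounded hS.isOpen' (hOΩ hx)] with y hy
    obtain ⟨s, hs, hxs, hys⟩ := hy
    have hsP := hS.notMem_of_uncracked hP hx (s := ⟨s, hs⟩) hxs
    exact ⟨tendsto_iff_of_mem_simplex hv (hgrad _ hsP) hys hxs,
      tendsto_iff_of_mem_simplex hv (hgrad _ hsP) hxs hys⟩
  let A : Set (E d) := {x | x ∈ O ∧ Tendsto (fun n => v n x) atTop (𝓝 0)}
  let B : Set (E d) := {x | x ∈ O ∧ ¬ Tendsto (fun n => v n x) atTop (𝓝 0)}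
  have hA : IsOpen A := isOpen_iff_mem_nhds.2 fun x hx => by
    filter_upwards [hloc x hx.1, hOo.mem_nhds hx.1] with y hy hyO using ⟨hyO, hy.2 hx.2⟩
  have hB : IsOpen B := isOpen_iff_mem_nhds.2 fun x hx => by
    filter_upwards [hloc x hx.1, hOo.mem_nhds hx.1] with y hy hyO using
      ⟨hyO, fun hcon => hx.2 (hy.1 hcon)⟩
  have hAB : Disjoint A B := Set.disjoint_left.2 fun x hxA hxB => hxB.2 hxA.2
  have hzO : z ∈ O := Or.inr hz
  have hsub : connectedComponentIn O z ⊆ A := by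
    refine isPreconnected_connectedComponentIn.subset_left_of_subset_union hA hB hAB ?_
      ⟨z, mem_connectedComponentIn hzO, hzO, hout z hz⟩
    intro x hx
    have hxO := connectedComponentIn_subset O z hx
    by_cases hcon : Tendsto (fun n => v n x) atTop (𝓝 0)
    · exact Or.inl ⟨hxO, hcon⟩
    · exact Or.inr ⟨hxO, hcon⟩
  exact (hsub hxz).2

theorem tendsto_eLpNorm_goodSet [Fintype (cells K Ω')] (hS : IsSetting K h Ω Ω' C κ ε)
    (hP : P ⊆ freeCells K Ω Ω') (hv : ∀ n, v n ∈ contFE K Ω')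
    (hgrad : ∀ s ∉ P, Tendsto (fun n => cellGrad s.1 (v n)) atTop (𝓝 0))
    (hout : ∀ x ∈ Ω' \ closure Ω, Tendsto (fun n => v n x) atTop (𝓝 0)) (p : ENNReal) :
    Tendsto (fun n => eLpNorm (v n) p (volume.restrict (goodSet K Ω Ω' ε (region P))))
      atTop (𝓝 0) := by
  set G := goodSet K Ω Ω' ε (region P) with hG
  have hGO : G ⊆ (Ω' \ meshNhd K ε (region P)) ∪ (Ω' \ closure Ω) :=
    iUnion₂_subset fun z _ => connectedComponentIn_subset _ _
  have hGΩ : G ⊆ Ω' := hGO.trans (union_subset sdiff_subset sdiff_subset)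
  have hGo : IsOpen G := isOpen_biUnion fun z _ => (hS.isOpen_uncracked P).connectedComponentIn
  have : IsFiniteMeasure (volume.restrict G) :=
    ⟨by simpa using (hS.bounded.subset hGΩ).measure_lt_top⟩
  refine tendsto_eLpNorm_zero_of_uniform fun δ hδ => ?_
  -- One point of the cell in `G` suffices: its value plus gradient times diameter bounds `v n` on
  -- the cell uniformly.
  have hcell : ∀ s : cells K Ω', ∀ᶠ n in atTop, ∀ x ∈ simplex s.1 ∩ G, ‖v n x‖ ≤ δ := by
    intro s
    rcases (simplex s.1 ∩ G).eq_empty_or_nonempty with hem | ⟨z, hzs, hzG⟩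
    · simp [hem]
    have hsP := hS.notMem_of_uncracked hP (hGO hzG) hzs
    have h1 := (hS.tendsto_of_mem_goodSet hP hv hgrad hout hzG).norm.add
      ((hgrad s hsP).norm.mul_const (Metric.diam (simplex s.1)))
    rw [norm_zero, norm_zero, zero_mul, add_zero] at h1
    filter_upwards [h1.eventually_le_const hδ] with n hn x hx
    refine le_trans ?_ hn
    have h2 := contFE.sub_eq_inner (hv n) s.2 hzs hx.1
    have h3 : v n x = v n z + inner ℝ (cellGrad s.1 (v n)) (x - z) := by rw [← h2]; ring
    rw [h3]
    refine (norm_add_le _ _).trans (add_le_add le_rfl ((norm_inner_le_norm _ _).trans ?_))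
    refine mul_le_mul_of_nonneg_left ?_ (norm_nonneg _)
    rw [← dist_eq_norm]
    exact Metric.dist_le_diam_of_mem (isCompact_simplex s.1).isBounded hx.1 hzs
  filter_upwards [eventually_all.2 hcell] with n hn
  filter_upwards [ae_restrict_mem hGo.measurableSet] with x hx
  obtain ⟨s, hs, hxs⟩ := mem_iUnion₂.1 (hS.mesh.subset_cellRegion hS.bounded hS.isOpen' (hGΩ hx))
  exact hn ⟨s, hs⟩ x ⟨hxs, hx⟩

end IsSetting

/-! ### The quasi-static evolution -/

/-- The strain on a cracked cell can be varied freely, so the strain concentrated on that cell is an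
allowed test. This makes the gradient cut off at the crack equal to the elastic strain almost
everywhere. -/
theorem IsSetting.equilibrium_apply_eq_zero {Ω Ω' : Set (E d)} [Fintype (cells K Ω')]
    {C : Matrix (Fin d) (Fin d) ℝ} {κ ε : ℝ} {P : Set (cells K Ω')}
    {T : Set (cells K Ω') → (cells K Ω' → E d) →ₗ[ℝ] (cells K Ω' → E d)}
    (hS : IsSetting K h Ω Ω' C κ ε) (hT : IsEquilibriumMap Ω C T) (hP : P ⊆ freeCells K Ω Ω')
    (X : cells K Ω' → E d) {s : cells K Ω'} (hs : s ∈ P) : T P X s = 0 := by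
  classical
  have hmem : Pi.single s (T P X s) ∈ variations (K := K) Ω P := by
    refine mem_variations.2 ⟨0, Submodule.zero_mem _, fun t ht => ?_⟩
    have hts : t ≠ s := fun hcon => ht (hcon ▸ hs)
    rw [Pi.single_eq_of_ne hts, map_zero]
  have h0 := (hT P hP).2 X _ hmem
  rw [elasticForm_apply, Finset.sum_eq_single s, Pi.single_eq_same] at h0
  · by_contra hne
    exact (mul_pos (hS.cellWeight_pos (hP hs)) (hS.pos _ hne)).ne' h0
  · intro t _ hts
    rw [Pi.single_eq_of_ne hts]
    simp [form]
  · simp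

/-- Energy, strain and minimality of the states of a time-discrete solution. -/
theorem IsDiscreteSolution.characterization {Ω Ω' : Set (E d)} [Fintype (cells K Ω')]
    {C : Matrix (Fin d) (Fin d) ℝ} {κ ε : ℝ}
    {T : Set (cells K Ω') → (cells K Ω' → E d) →ₗ[ℝ] (cells K Ω' → E d)}
    (hS : IsSetting K h Ω Ω' C κ ε) (hT : IsEquilibriumMap Ω C T)
    {g : ℝ → E d → ℝ} {σ : ℕ → ℝ} {m : ℕ} {u : ℕ → E d → ℝ} {γ : ℕ → E d → E d}
    (hg : ∀ k ≤ m, g (σ k) ∈ contFE K Ω') (hsol : IsDiscreteSolution K Ω Ω' C κ ε g σ m u γ)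
    {k : ℕ} (hk : k ≤ m) :
    accumulatedCells K Ω' γ k ⊆ freeCells K Ω Ω' ∧
      strain K Ω' (u k) (γ k) = T (accumulatedCells K Ω' γ k) (meshGrad K Ω' (g (σ k))) ∧
      energy K Ω Ω' C κ ε (u k) (γ k) (discreteCrack K Ω' γ k) =
        reducedEnergy (elasticForm Ω C) T (crackEnergy κ ε) (accumulatedCells K Ω' γ k)
          (meshGrad K Ω' (g (σ k))) ∧
      -- Only cracks from before step `k` must lie in `P`. So the previous crack is itself a
      -- competitor, and for `k = 0` there is no constraint.
      ∀ P, (∀ j < k, accumulatedCells K Ω' γ j ⊆ P) → P ⊆ freeCells K Ω Ω' →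
        reducedEnergy (elasticForm Ω C) T (crackEnergy κ ε) (accumulatedCells K Ω' γ k)
          (meshGrad K Ω' (g (σ k))) ≤
        reducedEnergy (elasticForm Ω C) T (crackEnergy κ ε) P (meshGrad K Ω' (g (σ k))) := by
  have hfree : ∀ k ≤ m, accumulatedCells K Ω' γ k ⊆ freeCells K Ω Ω' := fun k hk =>
    iUnion₂_subset fun j hj => IsSetting.crackCells_subset (hsol.mem j (le_trans hj hk))
  refine ⟨hfree k hk, ?_⟩
  rw [discreteCrack_eq_region fun j hj => (hsol.mem j (hj.trans hk)).2.1]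
  rcases k with _ | k
  · obtain ⟨h1, h2, h3⟩ := hS.minimizer_characterization (P := ∅)
      (Q := accumulatedCells K Ω' γ 0) hT (empty_subset _) (hg 0 hk) (hsol.mem 0 hk)
      (by simpa only [region_empty] using hsol.initial)
      (by rw [accumulatedCells_zero, empty_union])
    exact ⟨h1, h2, fun P _ hP => h3 P (empty_subset _) hP⟩
  · have hmin := hsol.next k hk
    rw [discreteCrack_eq_region
      fun j hj => (hsol.mem j (hj.trans (Nat.le_of_succ_le hk))).2.1] at hmin
    obtain ⟨h1, h2, h3⟩ := hS.minimizer_characterization (P := accumulatedCells K Ω' γ k)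
      (Q := accumulatedCells K Ω' γ (k + 1)) hT (hfree k (Nat.le_of_succ_le hk)) (hg (k + 1) hk)
      (hsol.mem (k + 1) hk) hmin (accumulatedCells_succ _ _ _)
    exact ⟨h1, h2, fun P hkP hP => h3 P (hkP k (Nat.lt_succ_self k)) hP⟩

/-- The boundary value of a curve with absolutely continuous nodal values is attained in the
limit of the discrete times. -/
theorem sobolevCurves.tendsto_apply {D : Set (E d)} {g : ℝ → E d → ℝ} (hg : g ∈ sobolevCurves K D)
    (hx : x ∈ cellRegion K D) {τ : ℕ → ℕ → ℝ} (hτ : IsTimeGrid τ) {t : ℝ}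
    (ht : t ∈ Icc (0 : ℝ) 1) {φ : ℕ → ℕ} (hφ : StrictMono φ) :
    Tendsto (fun n => g (τ (φ n) (stepIndex (τ (φ n)) (φ n) t)) x) atTop (𝓝 (g t x)) := by
  have hc := (hg.2 x hx).continuousOn
  rw [uIcc_of_le zero_le_one] at hc
  refine (hc t ht).tendsto.comp (tendsto_nhdsWithin_iff.2
    ⟨(hτ.tendsto_stepIndex ht).comp hφ.tendsto_atTop, ?_⟩)
  exact Eventually.of_forall fun n => hτ.mem _ _ stepIndex_le

theorem IsSetting.exists_evolution {Ω Ω' : Set (E d)} {C : Matrix (Fin d) (Fin d) ℝ} {κ ε : ℝ}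
    (hS : IsSetting K h Ω Ω' C κ ε) {g : ℝ → E d → ℝ} (hg : g ∈ sobolevCurves K Ω')
    {τ : ℕ → ℕ → ℝ} (hτ : IsTimeGrid τ) {um : ℕ → ℕ → E d → ℝ} {γm : ℕ → ℕ → E d → E d}
    (hsol : ∀ m, IsDiscreteSolution K Ω Ω' C κ ε g (τ m) m (um m) (γm m)) :
    ∃ (u : ℝ → E d → ℝ) (γ : ℝ → E d → E d) (Γ : ℝ → Set (E d)),
      IsEvolution K Ω Ω' C κ ε g u γ Γ ∧
      ∃ φ : ℕ → ℕ, StrictMono φ ∧ ∀ t ∈ Icc (0 : ℝ) 1,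
        Tendsto (fun n => energy K Ω Ω' C κ ε
            (um (φ n) (stepIndex (τ (φ n)) (φ n) t))
            (γm (φ n) (stepIndex (τ (φ n)) (φ n) t))
            (discreteCrack K Ω' (γm (φ n)) (stepIndex (τ (φ n)) (φ n) t)))
          atTop (𝓝 (energy K Ω Ω' C κ ε (u t) (γ t) (Γ t))) ∧
        Tendsto (fun n => eLpNorm
            (fun x => um (φ n) (stepIndex (τ (φ n)) (φ n) t) x - u t x) 1
            (volume.restrict (goodSet K Ω Ω' ε (Γ t))))
          atTop (𝓝 0) ∧
        Tendsto (fun n => eLpNorm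
            (fun x =>
              (discreteCrack K Ω' (γm (φ n)) (stepIndex (τ (φ n)) (φ n) t))ᶜ.indicator
                  (gradient (um (φ n) (stepIndex (τ (φ n)) (φ n) t))) x -
                (gradient (u t) x - γ t x)) 2
            (volume.restrict Ω'))
          atTop (𝓝 0) := by
  have := hS.finite_cells.fintype
  obtain ⟨T, hT'⟩ := hS.exists_projection
  have hT : IsEquilibriumMap Ω C T := hT'
  have hI : uIcc (0 : ℝ) 1 = Icc 0 1 := uIcc_of_le zero_le_one
  have h01 : (0 : ℝ) ∈ Icc (0 : ℝ) 1 := by simp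
  let X : ℝ → cells K Ω' → E d := fun t => meshGrad K Ω' (g t)
  let Q : ℕ → ℕ → Set (cells K Ω') := fun m k => accumulatedCells K Ω' (γm m) k
  let e : Set (cells K Ω') → (cells K Ω' → E d) → ℝ :=
    reducedEnergy (elasticForm Ω C) T (crackEnergy κ ε)
  have hgτ : ∀ m, ∀ k ≤ m, g (τ m k) ∈ contFE K Ω' := fun m k hk => hg.1 _ (hτ.mem m k hk)
  have hchar := fun m k (hk : k ≤ m) =>
    IsDiscreteSolution.characterization hS hT (hgτ m) (hsol m) hk
  have hQmono : ∀ m, Monotone (Q m) := fun m => accumulatedCells_mono _ _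
  obtain ⟨Φ, hΦ, hΦX⟩ := sobolevCurves.exists_modulus hg
  have hTorth : ∀ P ⊆ freeCells K Ω Ω', ∀ F G : cells K Ω' → E d,
      elasticForm Ω C (F - T P F) (T P G) = 0 := fun P hP F G =>
    (hT P hP).2 G _ ((hT P hP).1 F)
  have hXd := sobolevCurves.ae_differentiableAt hg
  obtain ⟨φ, S, hφ, hQS, hXlim, hSfree, hSmono, hSstab, hEac, hEd⟩ :=
    exists_reduced_evolution (ν := crackEnergy κ ε) hS.elasticForm_isSymm hTorth hΦ hΦX hXd hτ
      (Q := Q) (fun m k hk => (hchar m k hk).1) hQmono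
      (fun m k hk P hkP hP => (hchar m k hk).2.2.2 P
        (fun j hj => (hQmono m hj.le).trans hkP) hP)
      (fun m k hk => (hchar m (k + 1) hk).2.2.2 (Q m k)
        (fun j hj => hQmono m (Nat.le_of_lt_succ hj)) (hchar m k hk.le).1)
  -- The state at time `t` is chosen as an equilibrium for `S t`, not as a limit of discrete states.
  -- On broken-off parts the discrete displacements are not controlled.
  have hex := fun t (ht : t ∈ Icc (0 : ℝ) 1) =>
    hS.exists_equilibrium (κ := κ) (ε := ε) hT (hSfree t ht) (hg.1 t ht)
  choose! p hp hpstrain hpcrack hple hpe using hex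
  have hstable : ∀ t ∈ Icc (0 : ℝ) 1, ∀ q ∈ admissible K Ω Ω' (g t),
      energy K Ω Ω' C κ ε (p t).1 (p t).2 (region (S t)) ≤
        energy K Ω Ω' C κ ε q.1 q.2 (region (S t)) := by
    intro t ht q hq
    rw [hpe t ht]
    exact (hSstab t ht _ subset_union_left
      (union_subset (hSfree t ht) (IsSetting.crackCells_subset hq))).trans
      (hS.reducedEnergy_le hT (hSfree t ht) (hg.1 t ht) hq)
  have hinit : ∀ q ∈ admissible K Ω Ω' (g 0),
      e (S 0) (X 0) ≤ energy K Ω Ω' C κ ε q.1 q.2 ∅ := by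
    intro q hq
    obtain ⟨n, hn⟩ := (hQS 0 h01).exists
    rw [hτ.stepIndex_zero] at hn
    have hmin := (hchar (φ n) 0 (Nat.zero_le _)).2.2.2 (∅ ∪ crackCells K Ω' q.2)
      (fun j hj => absurd hj (Nat.not_lt_zero j))
      (union_subset (empty_subset _) (IsSetting.crackCells_subset hq))
    rw [hτ.zero] at hmin
    have := hS.reducedEnergy_le hT (empty_subset _) (hg.1 0 h01) hq
    rw [region_empty] at this
    exact hn ▸ hmin.trans this
  -- At time zero, replacing the crack `S 0` by the empty pre-crack does not change the energy: a
  -- drop would contradict the minimality of `e (S 0) (X 0)`. Hence the balance may start from the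
  -- energy with `∅`.
  have hzero : energy K Ω Ω' C κ ε (p 0).1 (p 0).2 ∅ = e (S 0) (X 0) := by
    refine le_antisymm ?_ (hinit (p 0) (hp 0 h01))
    have := hple 0 h01 ∅ (empty_subset _)
    rwa [region_empty] at this
  have hpower : ∀ᵐ s : ℝ, s ∈ Ioo (0 : ℝ) 1 →
      deriv (fun t => e (S t) (X t)) s =
        2 * power Ω C g (fun t => (p t).1) (fun t => (p t).2) s := by
    filter_upwards [hEd, hXd] with s hs hds hs01
    have hsI := Ioo_subset_Icc_self hs01
    rw [(hs hs01).deriv, hS.power_eq hs01 hg.1 (hp s hsI).1 (hp s hsI).2.1 (hds hs01),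
      hpstrain s hsI]
  have hpower' : ∀ t ∈ Icc (0 : ℝ) 1, ∀ᵐ s : ℝ, s ∈ uIoc 0 t →
      deriv (fun t => e (S t) (X t)) s =
        2 * power Ω C g (fun t => (p t).1) (fun t => (p t).2) s := by
    intro t ht
    have h1 : ∀ᵐ s : ℝ, s ≠ 1 := by simp [ae_iff]
    filter_upwards [hpower, h1] with s hs hs1 hst
    rw [uIoc_of_le ht.1] at hst
    exact hs ⟨hst.1, lt_of_le_of_ne (hst.2.trans ht.2) hs1⟩
  refine ⟨fun t => (p t).1, fun t => (p t).2, fun t => region (S t),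
    ⟨fun t ht => ⟨hp t ht, ⟨Subtype.val '' S t, ?_, ?_⟩, ?_⟩, fun q hq => ?_, ?_, ?_, ?_, ?_, ?_⟩,
    φ, hφ, fun t ht => ?_⟩
  · rintro _ ⟨s, -, rfl⟩
    exact s.2
  · simp [region]
  · rw [support_eq_region (hp t ht).2.1]
    exact region_mono (hpcrack t ht)
  · rw [hzero]
    exact hinit q hq
  · exact fun s t hs hst ht => region_mono (hSmono ⟨hs, hst.trans ht⟩ ⟨hs.trans hst, ht⟩ hst)
  · exact fun t ht => hstable t (Ioc_subset_Icc_self ht)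
  · refine absolutelyContinuousOnInterval_of_dist_le (c := 1) hEac ?_
    rw [hI]
    intro s hs t ht
    rw [one_mul, hpe s hs, hpe t ht]
  · have hint := hEac.intervalIntegrable_deriv.const_mul (1 / 2)
    refine hint.congr_ae ?_
    refine (ae_restrict_iff' measurableSet_uIoc).2 ?_
    filter_upwards [hpower' 1 (by simp)] with s hs hs01
    rw [hs hs01]
    ring
  · intro t ht
    have hac : AbsolutelyContinuousOnInterval (fun t => e (S t) (X t)) 0 t := by
      refine hEac.mono ?_
      rw [hI]
      exact uIcc_subset_Icc h01 ht
    rw [hpe t ht, hzero, ← intervalIntegral.integral_const_mul,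
      ← intervalIntegral.integral_congr_ae (hpower' t ht), hac.integral_deriv_eq_sub]
    exact (add_sub_cancel _ _).symm
  · have hkm : ∀ n, stepIndex (τ (φ n)) (φ n) t ≤ φ n := fun n => stepIndex_le
    have hstrain : Tendsto (fun n => strain K Ω' (um (φ n) (stepIndex (τ (φ n)) (φ n) t))
        (γm (φ n) (stepIndex (τ (φ n)) (φ n) t))) atTop (𝓝 (strain K Ω' (p t).1 (p t).2)) := by
      rw [hpstrain t ht]
      refine (((T (S t)).continuous_of_finiteDimensional.tendsto _).comp (hXlim t ht)).congr' ?_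
      filter_upwards [hQS t ht] with n hn
      rw [(hchar _ _ (hkm n)).2.1, Function.comp_apply]
      exact congrArg (fun P => T P _) hn.symm
    have huncracked : ∀ s ∉ S t, ∀ᶠ n in atTop,
        cellValue (γm (φ n) (stepIndex (τ (φ n)) (φ n) t)) s = 0 := by
      intro s hs
      filter_upwards [hQS t ht] with n hn
      by_contra hcon
      refine hs (hn ▸ mem_biUnion (x := stepIndex (τ (φ n)) (φ n) t) (mem_Iic.2 le_rfl) ?_)
      exact hcon
    have huncracked' : ∀ s ∉ S t, cellValue (p t).2 s = 0 := fun s hs =>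
      not_not.1 fun hcon => hs (hpcrack t ht hcon)
    refine ⟨?_, ?_, ?_⟩
    · rw [hpe t ht]
      refine (((continuous_reducedEnergy (S t)).tendsto _).comp (hXlim t ht)).congr' ?_
      filter_upwards [hQS t ht] with n hn
      rw [(hchar _ _ (hkm n)).2.2.1, Function.comp_apply]
      exact congrArg (fun P => e P _) hn.symm
    · refine hS.tendsto_eLpNorm_goodSet (hSfree t ht)
        (v := fun n => um (φ n) (stepIndex (τ (φ n)) (φ n) t) - (p t).1)
        (fun n => contFE.sub ((hsol (φ n)).mem _ (hkm n)).1 (hp t ht).1) ?_ ?_ 1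
      · intro s hs
        have h1 := ((continuous_apply s).tendsto _).comp hstrain
        have h2 := h1.sub_const (strain K Ω' (p t).1 (p t).2 s)
        rw [sub_self] at h2
        refine h2.congr' ?_
        filter_upwards [huncracked s hs] with n hn
        simp [strain, hn, huncracked' s hs]
      · intro x hx
        have hxr := hS.mesh.subset_cellRegion hS.bounded hS.isOpen' hx.1
        have h1 := (sobolevCurves.tendsto_apply hg hxr hτ ht hφ).sub_const (g t x)
        rw [sub_self] at h1
        refine h1.congr fun n => ?_
        exact congrArg₂ (· - ·) (((hsol (φ n)).mem _ (hkm n)).2.2 x hx).1.symm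
          ((hp t ht).2.2 x hx).1.symm
    · have hfin : IsFiniteMeasure (volume.restrict Ω') :=
        ⟨by simpa using hS.bounded.measure_lt_top⟩
      refine tendsto_eLpNorm_zero_of_uniform fun δ hδ => ?_
      have h1 := (hstrain.sub_const (strain K Ω' (p t).1 (p t).2)).norm
      rw [sub_self, norm_zero] at h1
      filter_upwards [hQS t ht, h1.eventually_le_const hδ,
        eventually_all.2 fun s => eventually_imp_distrib_left.2 (huncracked s)] with n hn hδn hun
      filter_upwards [ae_restrict_of_ae hS.mesh.ae_regular,
        ae_restrict_mem hS.isOpen'.measurableSet] with x hxr hx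
      obtain ⟨s, hs, hxs⟩ := hS.mesh.exists_cell hxr hx
      have hsol' := (hsol (φ n)).mem _ (hkm n)
      have hcrack : x ∈ discreteCrack K Ω' (γm (φ n)) (stepIndex (τ (φ n)) (φ n) t) ↔
          (⟨s, hs⟩ : cells K Ω') ∈ S t := by
        rw [discreteCrack_eq_region fun j hj => ((hsol (φ n)).mem j (hj.trans (hkm n))).2.1, ← hn]
        exact mem_region_iff_of_interior (s := ⟨s, hs⟩) hxr hxs
      -- On cracked cells both sides vanish, the right one by equilibrium; on uncracked cells the
      -- eigenstrain is zero and the strain is the gradient.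
      have hkey : (discreteCrack K Ω' (γm (φ n)) (stepIndex (τ (φ n)) (φ n) t))ᶜ.indicator
          (gradient (um (φ n) (stepIndex (τ (φ n)) (φ n) t))) x =
          strain K Ω' (um (φ n) (stepIndex (τ (φ n)) (φ n) t))
            (γm (φ n) (stepIndex (τ (φ n)) (φ n) t)) ⟨s, hs⟩ := by
        by_cases hsS : (⟨s, hs⟩ : cells K Ω') ∈ S t
        · rw [indicator_of_notMem (notMem_compl_iff.2 (hcrack.2 hsS)), (hchar _ _ (hkm n)).2.1]
          refine (hS.equilibrium_apply_eq_zero hT (hchar _ _ (hkm n)).1 _ ?_).symm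
          exact (show accumulatedCells K Ω' _ _ = S t from hn) ▸ hsS
        · rw [indicator_of_mem (mem_compl fun hcon => hsS (hcrack.1 hcon)),
            contFE.gradient_eq hsol'.1 hs hxs, strain, hun _ hsS, sub_zero]
      rw [hkey, IsSetting.strain_eq (hp t ht).1 (hp t ht).2.1 ⟨s, hs⟩ hxs]
      exact (norm_le_pi_norm (strain K Ω' (um (φ n) (stepIndex (τ (φ n)) (φ n) t))
        (γm (φ n) (stepIndex (τ (φ n)) (φ n) t)) - strain K Ω' (p t).1 (p t).2)
        ⟨s, hs⟩).trans hδn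

end Eigenfracture

theorem theorem2p1 {d : ℕ} (K : Mesh d) (h : ℝ) (hh : 0 < h) (hK : IsTriangulation K h)
    (Ω Ω' : Set (E d)) (hΩ : IsOpen Ω) (hΩ' : IsOpen Ω') (hsub : Ω ⊆ Ω')
    (hbdd : Bornology.IsBounded Ω')
    (C : Matrix (Fin d) (Fin d) ℝ) (hCsymm : C.IsSymm)
    (hCpos : ∀ F : E d, F ≠ 0 → 0 < form C F F)
    (κ ε : ℝ) (hκ : 0 < κ) (hε : 0 < ε)
    (g : ℝ → E d → ℝ) (hg : g ∈ sobolevCurves K Ω')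
    (τ : ℕ → ℕ → ℝ) (hτ : IsTimeGrid τ) :
    -- the incremental problems are solvable
    (∀ m, ∃ (u : ℕ → E d → ℝ) (γ : ℕ → E d → E d),
      IsDiscreteSolution K Ω Ω' C κ ε g (τ m) m u γ) ∧
    -- any choice of solutions converges, along a subsequence, to an evolution
    ∀ (um : ℕ → ℕ → E d → ℝ) (γm : ℕ → ℕ → E d → E d),
      (∀ m, IsDiscreteSolution K Ω Ω' C κ ε g (τ m) m (um m) (γm m)) →
      ∃ (u : ℝ → E d → ℝ) (γ : ℝ → E d → E d) (Γ : ℝ → Set (E d)),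
        IsEvolution K Ω Ω' C κ ε g u γ Γ ∧
        ∃ φ : ℕ → ℕ, StrictMono φ ∧ ∀ t ∈ Icc (0 : ℝ) 1,
          Tendsto (fun n => energy K Ω Ω' C κ ε
              (um (φ n) (stepIndex (τ (φ n)) (φ n) t))
              (γm (φ n) (stepIndex (τ (φ n)) (φ n) t))
              (discreteCrack K Ω' (γm (φ n)) (stepIndex (τ (φ n)) (φ n) t)))
            atTop (𝓝 (energy K Ω Ω' C κ ε (u t) (γ t) (Γ t))) ∧
          Tendsto (fun n => eLpNorm
              (fun x => um (φ n) (stepIndex (τ (φ n)) (φ n) t) x - u t x) 1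
              (volume.restrict (goodSet K Ω Ω' ε (Γ t))))
            atTop (𝓝 0) ∧
          Tendsto (fun n => eLpNorm
              (fun x =>
                (discreteCrack K Ω' (γm (φ n)) (stepIndex (τ (φ n)) (φ n) t))ᶜ.indicator
                    (gradient (um (φ n) (stepIndex (τ (φ n)) (φ n) t))) x -
                  (gradient (u t) x - γ t x)) 2
              (volume.restrict Ω'))
            atTop (𝓝 0) := by
  have hS : IsSetting K h Ω Ω' C κ ε :=
    ⟨hK, hΩ, hΩ', hsub, hbdd, hCsymm, hCpos, hκ, hε⟩
  exact ⟨fun m => hS.exists_discreteSolution fun k hk => hg.1 _ (hτ.mem m k hk),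
    fun um γm hsol => hS.exists_evolution hg hτ hsol⟩
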